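/- Let $k\ge 1$ be an integer. A simple digraph is a finite digraph without loops and with at most one edge $xy$ in each direction between any two vertices (so $xy$ and $yx$ may both be present); its maximum total degree $\Delta(G)$ is the maximum over all vertices $v$ of $d^-(v)+d^+(v)$, the sum of the in-degree and the out-degree (with $\Delta(G)=0$ if $G$ has no vertices). Every simple digraph $G$ with $\Delta(G)\le 2k-1$ has an equitable acyclic $k$-coloring, that is, a partition of its vertex set into $k$ (possibly empty) color classes whose sizes pairwise differ by at most one, such that each class induces a subdigraph with no directed cycle, where a pair of edges $xy,yx$ counts as a directed cycle (a $2$-cycle). In consequence (Hajnal–Szemerédi theorem), every finite simple undirected graph with maximum degree at most $k-1$ has an equitable $k$-coloring, that is, a proper $k$-coloring whose $k$ (possibly empty) color classes pairwise differ in size by at most one. -/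

import Mathlib

namespace Digraph

variable {V : Type*}

/-- A digraph is simple if it has no loops. (Since the edges form a relation, there is at most one
edge from `x` to `y`, hence at most the two edges `xy` and `yx` between two vertices.) -/
def IsSimple (G : Digraph V) : Prop := ∀ v, ¬ G.Adj v v

/-- The in-degree of `v`: the number of edges `uv`. -/
noncomputable def inDegree (G : Digraph V) (v : V) : ℕ := {u | G.Adj u v}.ncard

/-- The out-degree of `v`: the number of edges `vw`. -/
noncomputable def outDegree (G : Digraph V) (v : V) : ℕ := {w | G.Adj v w}.ncard

/-- The total degree of `v`. -/
noncomputable def totalDegree (G : Digraph V) (v : V) : ℕ := G.inDegree v + G.outDegree v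

/-- The maximum total degree of a finite digraph (`0` if there are no vertices). -/
noncomputable def maxTotalDegree [Fintype V] (G : Digraph V) : ℕ := Finset.univ.sup G.totalDegree

/-- The subdigraph induced by a set of vertices. -/
def induce (G : Digraph V) (S : Set V) : Digraph S := ⟨fun x y => G.Adj x y⟩

/-- `c` is a directed cycle of `G`: a nonempty cyclic sequence of distinct vertices, each of which
has an edge to the next one (and the last one to the first one). Sequences of length two are
2-cycles. -/
def IsDirectedCycle (G : Digraph V) (c : Cycle V) : Prop :=
  c ≠ Cycle.nil ∧ c.Nodup ∧ c.Chain G.Adj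

/-- A digraph is acyclic if it has no directed cycle. -/
def IsAcyclic (G : Digraph V) : Prop := ∀ c : Cycle V, ¬ G.IsDirectedCycle c

end Digraph

/-- A `k`-coloring is equitable if the sizes of any two of its `k` color classes (possibly empty
ones) differ by at most one. -/
def IsEquitableColoring {V : Type*} {k : ℕ} (f : V → Fin k) : Prop :=
  ∀ i j : Fin k, (f ⁻¹' {i}).ncard ≤ (f ⁻¹' {j}).ncard + 1

/-- An equitable acyclic `k`-coloring of a digraph. -/
def Digraph.IsEquitableAcyclicColoring {V : Type*} (G : Digraph V) {k : ℕ} (f : V → Fin k) :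
    Prop :=
  (∀ i : Fin k, (G.induce (f ⁻¹' {i})).IsAcyclic) ∧ IsEquitableColoring f

/-!
The proof extends the Kierstead–Kostochka proof of the Hajnal–Szemerédi theorem to digraphs.

Padding with a complete digraph reduces to `k * s` vertices and classes of size exactly `s`
(`exists_equitable`). Edges are introduced vertex by vertex. As a vertex has total degree at most
`2k - 1`, it has at most one edge to some class and can be moved there; at worst this leaves a
*nearly equitable* coloring, with one class `p` of size `s - 1` and one class `P` of size `s + 1`.

Let `A` be the set of classes from which `p` can be reached by moving single vertices, `B` the set
of vertices outside these classes, and `q` the number of classes outside `A`. If `P` is in `A`,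
vertices are shifted along a walk (`exists_shift`). Otherwise no vertex of `B` can be added to a
class of `A`, so it has two edges to each of them, and degrees inside `B` are at most `2q - 1`; so
`B` minus a vertex has an equitable coloring with `q` colors by induction. Choose a set `T` of
classes of `A`, none of which is needed by the others to reach `p` (`exists_terminal`).

* If some `z` in a class `W` of `T` can be replaced in `W` by a vertex of `B` and can itself be
  moved to another class of `A`, the coloring is completed directly (`hasEquitable_of_move`).
* Otherwise a pair `x`, `y` of vertices of `B` is found that can together replace such a `z`
  (`exists_replacing_pair`). Then `x` goes to `W` and `z` to a class outside `A`; now `y` can be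
  moved to `W`, so that more classes reach `p` (`exists_nearlyEquitable_insert`).

The counting behind the second alternative is tight in the degree bound `2k - 1`, which is one more
than in the undirected case. Two observations recover this one edge. First, an edge between `y` and
a vertex `z` of an acyclic set `S` matters for cycles in `S + y` only if it belongs to a 2-cycle or
if `z` is not isolated in `S`; hence the number of relevant edges at an isolated `z` is even
(`relDeg_le`). Second, the pair is sought in a maximum acyclic subset `I` of `B`, where two vertices
are joined by at most one edge; each vertex of `I` gains a unit from an edge inside `I` or from
parity (`le_sum_soloWeight`), while a vertex `z` can only receive two (`sum_soloWeight_le_two`).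
-/

namespace EquitableAcyclic

open Finset
open scoped Classical

noncomputable section

variable {V ι : Type*}

/-! ### Acyclic vertex sets -/

section

/-- The vertex set `S` induces an acyclic subdigraph of `E`. Acyclicity is encoded by an integer
rank that increases along every edge inside `S`; for finite `S` this is equivalent to the absence
of directed cycles. -/
def Acyc (E : V → V → Prop) (S : Finset V) : Prop :=
  ∃ r : V → ℤ, ∀ x ∈ S, ∀ y ∈ S, E x y → r x < r y

/-- The number of edges (`0`, `1` or `2`) between `x` and `y`. -/
def mult (E : V → V → Prop) (x y : V) : ℕ :=
  (if E x y then 1 else 0) + (if E y x then 1 else 0)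

/-- The number of edges between `x` and the vertices of `S`. -/
def deg (E : V → V → Prop) (x : V) (S : Finset V) : ℕ := ∑ y ∈ S, mult E x y

variable {E : V → V → Prop} {S T : Finset V} {v x y z : V}

lemma Acyc.mono (h : Acyc E T) (hST : S ⊆ T) : Acyc E S := by
  obtain ⟨r, hr⟩ := h
  exact ⟨r, fun x hx y hy => hr x (hST hx) y (hST hy)⟩

lemma Acyc.swap (h : Acyc E S) : Acyc (Function.swap E) S := by
  obtain ⟨r, hr⟩ := h
  exact ⟨fun x => - r x, fun x hx y hy hxy => neg_lt_neg (hr y hy x hx hxy)⟩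

lemma acyc_swap_iff : Acyc (Function.swap E) S ↔ Acyc E S :=
  ⟨fun h => h.swap, fun h => h.swap⟩

lemma acyc_empty : Acyc E ∅ := ⟨fun _ => 0, by simp⟩

lemma Acyc.not_two_cycle (h : Acyc E S) (hx : x ∈ S) (hy : y ∈ S) (hxy : E x y) : ¬ E y x := by
  obtain ⟨r, hr⟩ := h
  intro hyx
  exact lt_asymm (hr x hx y hy hxy) (hr y hy x hx hyx)

lemma mult_comm (x y : V) : mult E x y = mult E y x := by
  unfold mult; omega

lemma mult_swap (x y : V) : mult (Function.swap E) x y = mult E x y := by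
  unfold mult Function.swap; omega

lemma deg_swap (x : V) (S : Finset V) : deg (Function.swap E) x S = deg E x S := by
  simp [deg, mult_swap]

lemma deg_mono (h : S ⊆ T) : deg E x S ≤ deg E x T :=
  sum_le_sum_of_subset h

lemma mult_le_deg (h : y ∈ S) : mult E x y ≤ deg E x S :=
  single_le_sum (f := fun y => mult E x y) (fun _ _ => Nat.zero_le _) h

lemma one_le_mult (h : E x y) : 1 ≤ mult E x y := by
  simp [mult, h]

lemma mult_pos_iff : mult E x y ≠ 0 ↔ E x y ∨ E y x := by
  unfold mult; split_ifs <;> simp_all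

lemma Acyc.insert_of_no_out (hv : ¬ E v v) (h : Acyc E S) (hout : ∀ z ∈ S, ¬ E v z) :
    Acyc E (insert v S) := by
  obtain ⟨r, hr⟩ := h
  obtain ⟨M, hM⟩ := (S.image r).bddAbove
  have hM' : ∀ x ∈ S, r x ≤ M := fun x hx => hM (by simpa using ⟨x, hx, rfl⟩)
  refine ⟨fun x => if x = v then M + 1 else r x, fun x hx y hy hxy => ?_⟩
  rw [mem_insert] at hx hy
  by_cases hxv : x = v
  · subst hxv
    rcases hy with rfl | hy
    · exact absurd hxy hv
    · exact absurd hxy (hout y hy)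
  · have hxS := hx.resolve_left hxv
    by_cases hyv : y = v
    · simp only [hxv, hyv, if_true, if_false]
      linarith [hM' x hxS]
    · simp only [hxv, hyv, if_false]
      exact hr x hxS y (hy.resolve_left hyv) hxy

/-! ### Relevant edges -/

/-- The edge `yz` from a vertex `y` to a vertex `z` of `S` is relevant if it may lie on a directed
cycle of `S + y`: either it is part of a 2-cycle, or `z` is not isolated in `S`. -/
def RelOut (E : V → V → Prop) (S : Finset V) (y z : V) : Prop :=
  E y z ∧ (E z y ∨ deg E z S ≠ 0)

/-- The relevance of an edge `zy` from a vertex `z` of `S` to a vertex `y`. -/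
def RelIn (E : V → V → Prop) (S : Finset V) (y z : V) : Prop :=
  E z y ∧ (E y z ∨ deg E z S ≠ 0)

/-- The number of edges between the vertex `z` of `S` and `T` that are relevant for `S`. -/
def relDeg (E : V → V → Prop) (S : Finset V) (z : V) (T : Finset V) : ℕ :=
  ∑ y ∈ T, ((if RelOut E S y z then 1 else 0) + (if RelIn E S y z then 1 else 0))

lemma relOut_swap : RelOut (Function.swap E) S y z ↔ RelIn E S y z := by
  simp [RelOut, RelIn, deg_swap, Function.swap]

/-- A vertex that cannot be added to an acyclic set sends a relevant edge to it: otherwise all its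
out-neighbors in `S` would be sinks of `S + v`. -/
lemma exists_relOut (hv : ¬ E v v) (h : Acyc E S) (hn : ¬ Acyc E (insert v S)) :
    ∃ z ∈ S, RelOut E S v z := by
  by_contra! hcon
  apply hn
  obtain ⟨r, hr⟩ := h
  obtain ⟨M, hM⟩ := (S.image r).bddAbove
  have hM' : ∀ x ∈ S, r x ≤ M := fun x hx => hM (by simpa using ⟨x, hx, rfl⟩)
  have hiso : ∀ z ∈ S, E v z → ¬ E z v ∧ ∀ w ∈ S, ¬ E z w ∧ ¬ E w z := by
    intro z hz hvz
    have := hcon z hz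
    simp only [RelOut, not_and, not_or, not_not] at this
    refine ⟨(this hvz).1, fun w hw => ?_⟩
    have h0 : mult E z w ≤ 0 := (this hvz).2 ▸ mult_le_deg hw
    have := mult_pos_iff.not.1 (not_not.2 (Nat.le_zero.1 h0))
    exact not_or.1 this
  refine ⟨fun x => if x = v then M + 1 else if E v x then M + 2 else r x,
    fun x hx y hy hxy => ?_⟩
  rw [mem_insert] at hx hy
  by_cases hxv : x = v
  · subst hxv
    have hyx : y ≠ x := fun h => hv (h ▸ hxy)
    simp [hyx, hxy]
  have hxS := hx.resolve_left hxv
  by_cases hyv : y = v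
  · subst hyv
    have : ¬ E y x := fun h => (hiso x hxS h).1 hxy
    simp only [hxv, this, if_true, if_false]
    linarith [hM' x hxS]
  have hyS := hy.resolve_left hyv
  have h1 : ¬ E v x := fun h => ((hiso x hxS h).2 y hyS).1 hxy
  have h2 : ¬ E v y := fun h => ((hiso y hyS h).2 x hxS).2 hxy
  simp only [hxv, hyv, h1, h2, if_false]
  exact hr x hxS y hyS hxy

lemma exists_relIn (hv : ¬ E v v) (h : Acyc E S) (hn : ¬ Acyc E (insert v S)) :
    ∃ z ∈ S, RelIn E S v z := by
  obtain ⟨z, hz, h⟩ := exists_relOut (E := Function.swap E) hv h.swap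
    (fun h => hn (acyc_swap_iff.1 h))
  exact ⟨z, hz, relOut_swap.1 h⟩

lemma deg_eq_card (x : V) (S : Finset V) :
    deg E x S = #(S.filter (E x ·)) + #(S.filter (E · x)) := by
  rw [card_filter, card_filter, ← sum_add_distrib]
  rfl

lemma two_le_deg (hv : ¬ E v v) (h : Acyc E S) (hn : ¬ Acyc E (insert v S)) :
    2 ≤ deg E v S := by
  obtain ⟨z, hz, hz'⟩ := exists_relOut hv h hn
  obtain ⟨w, hw, hw'⟩ := exists_relIn hv h hn
  rw [deg_eq_card]
  have h1 : 0 < #(S.filter (E v ·)) := card_pos.2 ⟨z, mem_filter.2 ⟨hz, hz'.1⟩⟩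
  have h2 : 0 < #(S.filter (E · v)) := card_pos.2 ⟨w, mem_filter.2 ⟨hw, hw'.1⟩⟩
  omega

lemma relDeg_le_deg : relDeg E S z T ≤ deg E z T := by
  refine sum_le_sum fun y _ => ?_
  unfold mult RelOut RelIn
  split_ifs <;> simp_all

lemma even_relDeg (h : deg E z S = 0) : Even (relDeg E S z T) := by
  refine Finset.even_sum _ fun y _ => ?_
  by_cases h1 : E y z <;> by_cases h2 : E z y <;> simp [RelOut, RelIn, h, h1, h2]

/-- Parity saves one edge: a vertex isolated in `S` has an even relevant degree. -/
lemma relDeg_le {n : ℕ} (h : deg E z S + deg E z T ≤ 2 * n + 1) : relDeg E S z T ≤ 2 * n := by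
  have h1 : relDeg E S z T ≤ deg E z T := relDeg_le_deg
  by_cases h0 : deg E z S = 0
  · obtain ⟨m, hm⟩ := even_relDeg (T := T) h0
    omega
  · omega

/-- Double counting of relevant edges between an acyclic set and vertices that cannot be added. -/
lemma two_mul_card_le_sum_relDeg (hE : ∀ v, ¬ E v v) (h : Acyc E S)
    (hn : ∀ y ∈ T, ¬ Acyc E (insert y S)) : 2 * #T ≤ ∑ z ∈ S, relDeg E S z T := by
  unfold relDeg
  rw [sum_comm, mul_comm, ← smul_eq_mul, ← sum_const]
  refine sum_le_sum fun y hy => ?_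
  rw [sum_add_distrib, ← card_filter, ← card_filter]
  obtain ⟨z, hz, hz'⟩ := exists_relOut (hE y) h (hn y hy)
  obtain ⟨w, hw, hw'⟩ := exists_relIn (hE y) h (hn y hy)
  have h1 : 0 < #(S.filter (RelOut E S y ·)) := card_pos.2 ⟨z, mem_filter.2 ⟨hz, hz'⟩⟩
  have h2 : 0 < #(S.filter (RelIn E S y ·)) := card_pos.2 ⟨w, mem_filter.2 ⟨hw, hw'⟩⟩
  omega

/-- If `z` is the only vertex of `S` to which `y` sends a relevant edge, then `y` can replace
`z` in `S`. -/
lemma Acyc.insert_erase_of_relOut (hE : ∀ v, ¬ E v v) (h : Acyc E S)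
    (hu : ∀ w ∈ S, RelOut E S y w → w = z) : Acyc E (insert y (S.erase z)) := by
  by_contra hn
  obtain ⟨w, hw, hw'⟩ := exists_relOut (hE y) (h.mono (erase_subset z S)) hn
  have hwS := mem_of_mem_erase hw
  refine ne_of_mem_erase hw (hu w hwS ⟨hw'.1, hw'.2.imp id fun h0 h1 => h0 ?_⟩)
  exact Nat.le_zero.1 (h1 ▸ deg_mono (erase_subset z S))

lemma Acyc.insert_erase_of_relIn (hE : ∀ v, ¬ E v v) (h : Acyc E S)
    (hu : ∀ w ∈ S, RelIn E S y w → w = z) : Acyc E (insert y (S.erase z)) :=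
  acyc_swap_iff.1 (Acyc.insert_erase_of_relOut (E := Function.swap E) hE h.swap
    fun w hw h => hu w hw (relOut_swap.1 h))

lemma deg_union (h : Disjoint S T) : deg E x (S ∪ T) = deg E x S + deg E x T :=
  sum_union h

lemma acyc_insert_of_deg_le_one (hE : ∀ v, ¬ E v v) (h : Acyc E S) (hd : deg E v S ≤ 1) :
    Acyc E (insert v S) := by
  by_contra hn
  have := two_le_deg (hE v) h hn
  omega

end

/-! ### Reachability among color classes -/

section

/-- `c` reaches `p` by a walk of the relation `H` all of whose steps stay in `D`. -/
def Reach (H : ι → ι → Prop) (D : Finset ι) (c p : ι) : Prop :=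
  Relation.ReflTransGen (fun a b => a ∈ D ∧ b ∈ D ∧ H a b) c p

variable {H : ι → ι → Prop} {D D' : Finset ι} {a b c p : ι}

lemma Reach.mono_of_imp {H' : ι → ι → Prop} (h : Reach H D c p)
    (hH : ∀ a ∈ D, ∀ b ∈ D, H a b → a ∈ D' ∧ b ∈ D' ∧ H' a b) : Reach H' D' c p :=
  Relation.ReflTransGen.mono (fun a b (hab : a ∈ D ∧ b ∈ D ∧ H a b) =>
    hH a hab.1 b hab.2.1 hab.2.2) _ _ h

lemma Reach.mono (h : Reach H D c p) (hD : D ⊆ D') : Reach H D' c p :=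
  h.mono_of_imp fun _ ha _ hb hab => ⟨hD ha, hD hb, hab⟩

lemma Reach.refl : Reach H D p p := Relation.ReflTransGen.refl

lemma Reach.head (ha : a ∈ D) (hb : b ∈ D) (hab : H a b) (h : Reach H D b p) : Reach H D a p :=
  Relation.ReflTransGen.head ⟨ha, hb, hab⟩ h

/-- A walk from `a` to `p` either avoids `c`, or leaves `c` for a last time. -/
lemma Reach.avoid_or_exit (h : Reach H D a p) (hp : p ≠ c) :
    Reach H (D.erase c) a p ∧ a ≠ c ∨
      c ∈ D ∧ ∃ b ∈ D.erase c, H c b ∧ Reach H (D.erase c) b p := by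
  induction h using Relation.ReflTransGen.head_induction_on with
  | refl => exact Or.inl ⟨Reach.refl, hp⟩
  | @head x y hab _ ih =>
    rcases ih with ⟨ih, hy⟩ | ih
    · by_cases hx : x = c
      · subst hx
        exact Or.inr ⟨hab.1, y, mem_erase.2 ⟨hy, hab.2.1⟩, hab.2.2, ih⟩
      · exact Or.inl ⟨ih.head (mem_erase.2 ⟨hx, hab.1⟩) (mem_erase.2 ⟨hy, hab.2.1⟩) hab.2.2, hx⟩
    · exact Or.inr ih

lemma Reach.exit (h : Reach H D c p) (hp : p ≠ c) :
    c ∈ D ∧ ∃ b ∈ D.erase c, H c b ∧ Reach H (D.erase c) b p := by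
  rcases h.avoid_or_exit hp with h | h
  · exact absurd rfl h.2
  · exact h

/-- In a finite relation in which everything reaches `p`, there are a vertex `U` and a nonempty set
`T` such that all steps from `T` go to `T + U`, and deleting any single member of `T` does not
disconnect the others from `p`. Here `T` is a minimal set of the form "cut off from `p` by the
deletion of `U`". -/
lemma exists_terminal (hp : p ∈ D) (hD : ∀ c ∈ D, Reach H D c p) (hcard : 2 ≤ #D) :
    ∃ U ∈ D, ∃ T ⊆ D.erase U, T.Nonempty ∧ p ∉ T ∧
      (∀ W ∈ T, ∀ c ∈ D, c ≠ W → Reach H (D.erase W) c p) ∧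
      (∀ W ∈ T, ∀ c ∈ D, c ≠ U → c ∉ T → ¬ H W c) := by
  let cut : ι → Finset ι := fun U =>
    (D.erase U).filter fun c => U = p ∨ ¬ Reach H (D.erase U) c p
  have hcutp : (cut p).Nonempty := by
    have : 0 < #(D.erase p) := by rw [card_erase_of_mem hp]; omega
    obtain ⟨c, hc⟩ := card_pos.1 this
    exact ⟨c, mem_filter.2 ⟨hc, Or.inl rfl⟩⟩
  obtain ⟨U, hU, hmin⟩ := exists_min_image (D.filter fun U => (cut U).Nonempty)
    (fun U => #(cut U)) ⟨p, mem_filter.2 ⟨hp, hcutp⟩⟩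
  rw [mem_filter] at hU
  have hpU : p ∉ cut U := by
    intro h
    rw [mem_filter, mem_erase] at h
    rcases h.2 with h' | h'
    · exact h.1.1 h'.symm
    · exact h' Reach.refl
  -- Walks from outside `cut U` can be chosen to avoid `cut U`.
  have havoid : ∀ c ∈ D, c ∉ cut U → ∀ W ∈ cut U, Reach H (D.erase W) c p := by
    intro c hc hcU W hW
    have hWp : W ≠ p := fun h => hpU (h ▸ hW)
    by_cases hUp : U = p
    · have : c = p := by
        by_contra hcp
        exact hcU (mem_filter.2 ⟨mem_erase.2 ⟨hUp ▸ hcp, hc⟩, Or.inl hUp⟩)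
      exact this ▸ Reach.refl
    have hmem : ∀ d ∈ D.erase U, Reach H (D.erase U) d p → d ∈ D.erase W := by
      intro d hd hdr
      refine mem_erase.2 ⟨?_, mem_of_mem_erase hd⟩
      rintro rfl
      rcases (mem_filter.1 hW).2 with h | h
      · exact hUp h
      · exact h hdr
    have key : ∀ d, Reach H (D.erase U) d p → Reach H (D.erase W) d p := by
      intro d hd
      induction hd using Relation.ReflTransGen.head_induction_on with
      | refl => exact Reach.refl
      | head hab hbp ih =>
        exact ih.head (hmem _ hab.1 (Relation.ReflTransGen.head hab hbp))
          (hmem _ hab.2.1 hbp) hab.2.2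
    by_cases hcU' : c = U
    · subst hcU'
      obtain ⟨_, b, hb, hcb, hbr⟩ := (hD c hc).exit (Ne.symm hUp)
      refine (key b hbr).head (mem_erase.2 ⟨?_, hc⟩) (hmem b hb hbr) hcb
      rintro rfl
      exact hcU hW
    · apply key
      by_contra h
      exact hcU (mem_filter.2 ⟨mem_erase.2 ⟨hcU', hc⟩, Or.inr h⟩)
  refine ⟨U, hU.1, cut U, filter_subset _ _, hU.2, hpU, ?_, ?_⟩
  · intro W hW c hc hcW
    by_contra hcr
    have hWp : W ≠ p := fun h => hpU (h ▸ hW)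
    have hWD : W ∈ D := mem_of_mem_erase (mem_filter.1 hW).1
    have hcW' : c ∈ cut W := mem_filter.2 ⟨mem_erase.2 ⟨hcW, hc⟩, Or.inr hcr⟩
    have hle := hmin W (mem_filter.2 ⟨hWD, c, hcW'⟩)
    have hss : cut W ⊂ cut U := by
      refine ssubset_of_subset_of_ne ?_ ?_
      · intro d hd
        by_contra hdU
        rw [mem_filter, mem_erase] at hd
        rcases hd.2 with h | h
        · exact hWp h
        · exact h (havoid d hd.1.2 hdU W hW)
      · intro h
        rw [← h] at hW
        exact (mem_erase.1 (mem_filter.1 hW).1).1 rfl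
    exact absurd (card_lt_card hss) (not_lt.2 hle)
  · intro W hW c hc hcU hcT hWc
    have hW' := mem_filter.1 hW
    by_cases hUp : U = p
    · exact hcT (mem_filter.2 ⟨mem_erase.2 ⟨hcU, hc⟩, Or.inl hUp⟩)
    have hcr : Reach H (D.erase U) c p := by
      by_contra h
      exact hcT (mem_filter.2 ⟨mem_erase.2 ⟨hcU, hc⟩, Or.inr h⟩)
    rcases hW'.2 with h | h
    · exact hUp h
    · exact h (hcr.head hW'.1 (mem_erase.2 ⟨hcU, hc⟩) hWc)

/-! ### Moving vertices along walks of color classes -/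

/-- The color class of `c` in the vertex set `X`. -/
def cls (X : Finset V) (f : V → ι) (c : ι) : Finset V := X.filter (f · = c)

/-- Some vertex of class `c` can be moved to the different class `c'`, keeping that class
acyclic. -/
def Move (E : V → V → Prop) (X : Finset V) (f : V → ι) (c c' : ι) : Prop :=
  c ≠ c' ∧ ∃ y ∈ cls X f c, Acyc E (insert y (cls X f c'))

variable {E : V → V → Prop} {X : Finset V} {f : V → ι} {x : V}

lemma mem_cls : x ∈ cls X f c ↔ x ∈ X ∧ f x = c := mem_filter

/-- If `c` reaches `p` by moves inside `D`, one vertex can be moved along the walk from each class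
to the next one. In effect the class of `c` loses a vertex (and gains none), and the class of `p`
gains one. -/
lemma exists_shift (D : Finset ι) : ∀ c, Reach (Move E X f) D c p →
    (∀ d, Acyc E (cls X f d)) →
    ∃ f' : V → ι, (∀ x, f x ∉ D → f' x = f x) ∧ (∀ x, f x ∈ D → f' x ∈ D) ∧
      (∀ d, Acyc E (cls X f' d)) ∧ cls X f' c ⊆ cls X f c ∧
      ∀ d, #(cls X f' d) + (if d = c then 1 else 0) = #(cls X f d) + (if d = p then 1 else 0) := by
  induction D using Finset.strongInduction with
  | H D ih =>
  intro c hc hac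
  by_cases hcp : p = c
  · subst hcp
    exact ⟨f, fun _ _ => rfl, fun _ h => h, hac, Subset.rfl, fun d => rfl⟩
  obtain ⟨hcD, b, hb, ⟨hcb, y, hy, hyb⟩, hbr⟩ := hc.exit hcp
  obtain ⟨g, hg1, hg2, hg3, hg4, hg5⟩ := ih _ (erase_ssubset hcD) b hbr hac
  have hyX := (mem_cls.1 hy).1
  have hyc := (mem_cls.1 hy).2
  have hgy : g y = c := by rw [hg1 y (by simp [hyc]), hyc]
  have hgc : cls X g c = cls X f c := by
    ext x
    simp only [mem_cls]
    refine and_congr_right fun _ => ?_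
    by_cases hx : f x ∈ D.erase c
    · have h1 := (mem_erase.1 (hg2 x hx)).1
      have h2 := (mem_erase.1 hx).1
      simp [h1, h2]
    · rw [hg1 x hx]
  have hclsb : cls X (Function.update g y b) b = insert y (cls X g b) := by
    ext x
    by_cases hx : x = y
    · subst hx; simp [mem_cls, hyX]
    · simp [mem_cls, hx]
  have hclsc : cls X (Function.update g y b) c = (cls X g c).erase y := by
    ext x
    by_cases hx : x = y
    · subst hx; simp [mem_cls, hcb.symm]
    · simp [mem_cls, hx]
  have hcls : ∀ d, d ≠ b → d ≠ c → cls X (Function.update g y b) d = cls X g d := by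
    intro d hdb hdc
    ext x
    by_cases hx : x = y
    · subst hx; simp [mem_cls, hgy, hdb.symm, hdc.symm]
    · simp [mem_cls, hx]
  refine ⟨Function.update g y b, ?_, ?_, ?_, ?_, ?_⟩
  · intro x hx
    have hxy : x ≠ y := by rintro rfl; exact hx (hyc ▸ hcD)
    rw [Function.update_of_ne hxy, hg1 x (fun h => hx (mem_of_mem_erase h))]
  · intro x hx
    by_cases hxy : x = y
    · subst hxy; simpa using mem_of_mem_erase hb
    · rw [Function.update_of_ne hxy]
      by_cases hx' : f x ∈ D.erase c
      · exact mem_of_mem_erase (hg2 x hx')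
      · rw [hg1 x hx']; exact hx
  · intro d
    by_cases hdb : d = b
    · subst hdb
      rw [hclsb]
      exact hyb.mono (insert_subset_insert _ hg4)
    · by_cases hdc : d = c
      · subst hdc
        rw [hclsc]
        exact (hg3 d).mono (erase_subset _ _)
      · rw [hcls d hdb hdc]; exact hg3 d
  · rw [hclsc, hgc]; exact erase_subset _ _
  · intro d
    have h5 := hg5 d
    by_cases hdb : d = b
    · subst hdb
      have hyn : y ∉ cls X g d := by simp [mem_cls, hgy, hcb]
      rw [hclsb, card_insert_of_notMem hyn, if_neg hcb.symm]
      simpa using h5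
    · by_cases hdc : d = c
      · subst hdc
        have hyd : y ∈ cls X g d := by rw [hgc]; exact hy
        have := card_pos.2 ⟨y, hyd⟩
        rw [hclsc, card_erase_of_mem hyd, hgc]
        rw [hgc] at this
        simp only [if_true, if_neg (Ne.symm hcp)]
        omega
      · rw [hcls d hdb hdc, if_neg hdc]
        simpa [hdb] using h5

end

/-! ### Solo vertices -/

section

variable {E : V → V → Prop} {S B I : Finset V} {x y z : V}

/-- A nonempty predicate on `S` has at least two points, counting a unique point twice. -/
lemma two_le_sum_of_exists {R : V → Prop} (h : ∃ z ∈ S, R z) :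
    2 ≤ ∑ z ∈ S, ((if R z then 1 else 0) +
      (if R z ∧ ∀ w ∈ S, R w → w = z then 1 else 0)) := by
  obtain ⟨z, hz, hRz⟩ := h
  rw [sum_add_distrib, ← card_filter, ← card_filter]
  by_cases hu : ∀ w ∈ S, R w → w = z
  · have h1 : 0 < #(S.filter fun z => R z) := card_pos.2 ⟨z, mem_filter.2 ⟨hz, hRz⟩⟩
    have h2 : 0 < #(S.filter fun z => R z ∧ ∀ w ∈ S, R w → w = z) :=
      card_pos.2 ⟨z, mem_filter.2 ⟨hz, hRz, hu⟩⟩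
    omega
  · push Not at hu
    obtain ⟨w, hw, hRw, hwz⟩ := hu
    have h1 : 1 < #(S.filter fun z => R z) :=
      one_lt_card.2 ⟨w, mem_filter.2 ⟨hw, hRw⟩, z, mem_filter.2 ⟨hz, hRz⟩, hwz⟩
    omega

/-- If the vertices of an acyclic set `W` that can be replaced by a vertex of `B` have small degree
(at most `2q + 1`), then the degree bound `2(q + t) + 1` for the other vertices forces `q < t`.
Each vertex of `B` has at least two relevant in-edges and two relevant out-edges when a unique one
is counted twice; an edge counted twice ends in a replaceable vertex. -/
lemma lt_of_replaceable_deg_le {W : Finset V} {q t : ℕ} (hE : ∀ v, ¬ E v v) (hW : Acyc E W)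
    (hB : q * #W + 1 ≤ #B) (hn : ∀ y ∈ B, ¬ Acyc E (insert y W))
    (hdeg : ∀ z ∈ W, deg E z W + deg E z B ≤ 2 * (q + t) + 1)
    (hsolo : ∀ z ∈ W, ∀ y ∈ B, Acyc E (insert y (W.erase z)) →
      deg E z W + deg E z B ≤ 2 * q + 1) : q < t := by
  by_contra! hqt
  let g : V → V → ℕ := fun y z =>
    ((if RelOut E W y z then 1 else 0) +
      (if RelOut E W y z ∧ ∀ w ∈ W, RelOut E W y w → w = z then 1 else 0)) +
    ((if RelIn E W y z then 1 else 0) +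
      (if RelIn E W y z ∧ ∀ w ∈ W, RelIn E W y w → w = z then 1 else 0))
  have h1 : 4 * #B ≤ ∑ y ∈ B, ∑ z ∈ W, g y z := by
    rw [mul_comm, ← smul_eq_mul, ← sum_const]
    refine sum_le_sum fun y hy => ?_
    rw [sum_add_distrib]
    exact add_le_add (two_le_sum_of_exists (exists_relOut (hE y) hW (hn y hy)))
      (two_le_sum_of_exists (exists_relIn (hE y) hW (hn y hy)))
  have h2 : ∑ y ∈ B, ∑ z ∈ W, g y z ≤ ∑ z ∈ W, 4 * q := by
    rw [sum_comm]
    refine sum_le_sum fun z hz => ?_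
    by_cases hs : ∃ y ∈ B, Acyc E (insert y (W.erase z))
    · obtain ⟨y, hy, hyz⟩ := hs
      have h3 := relDeg_le (hsolo z hz y hy hyz)
      have h4 : ∑ y ∈ B, g y z ≤ 2 * relDeg E W z B := by
        rw [relDeg, mul_sum]
        refine sum_le_sum fun y _ => ?_
        dsimp only [g]
        split_ifs <;> simp_all
      omega
    · push Not at hs
      have h3 := relDeg_le (hdeg z hz)
      have h4 : ∑ y ∈ B, g y z = relDeg E W z B := by
        refine sum_congr rfl fun y hy => ?_
        have ho : ¬ (RelOut E W y z ∧ ∀ w ∈ W, RelOut E W y w → w = z) :=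
          fun h => hs y hy (hW.insert_erase_of_relOut hE h.2)
        have hi : ¬ (RelIn E W y z ∧ ∀ w ∈ W, RelIn E W y w → w = z) :=
          fun h => hs y hy (hW.insert_erase_of_relIn hE h.2)
        simp only [g, ho, hi, if_false, add_zero]
      omega
  rw [sum_const, smul_eq_mul] at h2
  nlinarith

/-- `z` is the only out-neighbor of `y` in `S`. -/
def SoloOut (E : V → V → Prop) (S : Finset V) (z y : V) : Prop :=
  E y z ∧ ∀ w ∈ S, E y w → w = z

/-- `z` is the only in-neighbor of `y` in `S`. -/
def SoloIn (E : V → V → Prop) (S : Finset V) (z y : V) : Prop :=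
  E z y ∧ ∀ w ∈ S, E w y → w = z

/-- The number of directions (in, out) in which `z` is the only neighbor of `y` in `S`. -/
def soloCount (E : V → V → Prop) (S : Finset V) (z y : V) : ℕ :=
  (if SoloOut E S z y then 1 else 0) + (if SoloIn E S z y then 1 else 0)

/-- The number `soloCount`, where a single solo direction counts twice if `y` is isolated
in `I`. -/
def soloWeight (E : V → V → Prop) (S I : Finset V) (z y : V) : ℕ :=
  soloCount E S z y + (if soloCount E S z y = 1 ∧ deg E y I = 0 then 1 else 0)

lemma SoloOut.not_adj (h : SoloOut E S z y) {w : V} (hw : w ∈ S.erase z) : ¬ E y w :=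
  fun hyw => ne_of_mem_erase hw (h.2 w (mem_of_mem_erase hw) hyw)

lemma SoloOut.acyc_insert (hE : ∀ v, ¬ E v v) (hS : Acyc E S) (h : SoloOut E S z y) :
    Acyc E (insert y (S.erase z)) :=
  (hS.mono (erase_subset z S)).insert_of_no_out (hE y) fun _ hw => h.not_adj hw

lemma SoloIn.acyc_insert (hE : ∀ v, ¬ E v v) (hS : Acyc E S) (h : SoloIn E S z y) :
    Acyc E (insert y (S.erase z)) :=
  acyc_swap_iff.1 (SoloOut.acyc_insert (E := Function.swap E) hE hS.swap h)

lemma SoloOut.acyc_insert_insert (hE : ∀ v, ¬ E v v) (h : SoloOut E S z x) (hxy : ¬ E x y)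
    (hy : Acyc E (insert y (S.erase z))) : Acyc E (insert x (insert y (S.erase z))) := by
  refine hy.insert_of_no_out (hE x) fun w hw => ?_
  rcases mem_insert.1 hw with rfl | hw
  · exact hxy
  · exact h.not_adj hw

lemma SoloIn.acyc_insert_insert (hE : ∀ v, ¬ E v v) (h : SoloIn E S z x) (hxy : ¬ E y x)
    (hy : Acyc E (insert y (S.erase z))) : Acyc E (insert x (insert y (S.erase z))) :=
  acyc_swap_iff.1 (SoloOut.acyc_insert_insert (E := Function.swap E) hE h hxy hy.swap)

/-- Two vertices of an acyclic set that are both out-solo to `z` can replace `z` together: one of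
them becomes a sink. -/
lemma card_filter_soloOut_le_one (hE : ∀ v, ¬ E v v) (hS : Acyc E S) (hI : Acyc E I)
    (hno : ∀ x ∈ I, ∀ y ∈ I, x ≠ y → SoloOut E S z x ∨ SoloIn E S z x →
      ¬ Acyc E (insert x (insert y (S.erase z)))) :
    #(I.filter fun y => SoloOut E S z y) ≤ 1 := by
  refine card_le_one.2 fun x hx y hy => ?_
  rw [mem_filter] at hx hy
  by_contra hxy
  by_cases h : E x y
  · exact hno y hy.1 x hx.1 (Ne.symm hxy) (Or.inl hy.2)
      (hy.2.acyc_insert_insert hE (hI.not_two_cycle hx.1 hy.1 h) (hx.2.acyc_insert hE hS))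
  · exact hno x hx.1 y hy.1 hxy (Or.inl hx.2)
      (hx.2.acyc_insert_insert hE h (hy.2.acyc_insert hE hS))

lemma card_filter_soloIn_le_one (hE : ∀ v, ¬ E v v) (hS : Acyc E S) (hI : Acyc E I)
    (hno : ∀ x ∈ I, ∀ y ∈ I, x ≠ y → SoloOut E S z x ∨ SoloIn E S z x →
      ¬ Acyc E (insert x (insert y (S.erase z)))) :
    #(I.filter fun y => SoloIn E S z y) ≤ 1 :=
  card_filter_soloOut_le_one (E := Function.swap E) hE hS.swap hI.swap
    fun x hx y hy hxy h h' => hno x hx y hy hxy h.symm (acyc_swap_iff.1 h')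

/-- If no two vertices of the acyclic set `I` can replace `z` together, then `z` receives a total
solo weight of at most two from `I`. -/
lemma sum_soloWeight_le_two (hE : ∀ v, ¬ E v v) (hS : Acyc E S) (hI : Acyc E I)
    (hno : ∀ x ∈ I, ∀ y ∈ I, x ≠ y → SoloOut E S z x ∨ SoloIn E S z x →
      ¬ Acyc E (insert x (insert y (S.erase z)))) :
    ∑ y ∈ I, soloWeight E S I z y ≤ 2 := by
  have hO := card_filter_soloOut_le_one hE hS hI hno
  have hN := card_filter_soloIn_le_one hE hS hI hno
  unfold soloWeight
  rw [sum_add_distrib]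
  conv_lhs => enter [1]; unfold soloCount
  rw [sum_add_distrib, ← card_filter, ← card_filter, ← card_filter]
  by_cases hL : ∃ y ∈ I, soloCount E S z y = 1 ∧ deg E y I = 0
  swap
  · push Not at hL
    have : I.filter (fun y => soloCount E S z y = 1 ∧ deg E y I = 0) = ∅ :=
      filter_eq_empty_iff.2 fun y hy h => hL y hy h.1 h.2
    rw [this, card_empty]
    omega
  obtain ⟨y, hy, hy1, hy0⟩ := hL
  have hiso : ∀ w ∈ I, ¬ E y w ∧ ¬ E w y := by
    intro w hw
    have h0 : mult E y w ≤ 0 := hy0 ▸ mult_le_deg hw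
    exact not_or.1 (mult_pos_iff.not.1 (not_not.2 (Nat.le_zero.1 h0)))
  have hsolo : SoloOut E S z y ∨ SoloIn E S z y := by
    by_contra! h
    simp [soloCount, h.1, h.2] at hy1
  have huniq : ∀ w ∈ I, SoloOut E S z w ∨ SoloIn E S z w → w = y := by
    intro w hw hws
    by_contra hwy
    refine hno y hy w hw (Ne.symm hwy) hsolo ?_
    have hw' : Acyc E (insert w (S.erase z)) :=
      hws.elim (fun h => h.acyc_insert hE hS) (fun h => h.acyc_insert hE hS)
    rcases hsolo with h | h
    · exact h.acyc_insert_insert hE (hiso w hw).1 hw'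
    · exact h.acyc_insert_insert hE (hiso w hw).2 hw'
  have hL1 : #(I.filter fun y => soloCount E S z y = 1 ∧ deg E y I = 0) ≤ 1 := by
    have : ∀ w ∈ I.filter (fun y => soloCount E S z y = 1 ∧ deg E y I = 0), w = y := by
      intro w hw
      rw [mem_filter] at hw
      refine huniq w hw.1 ?_
      by_contra! h
      simp [soloCount, h.1, h.2] at hw
    exact card_le_one.2 fun a ha b hb => (this a ha).trans (this b hb).symm
  by_cases ho : SoloOut E S z y
  · have hi : ¬ SoloIn E S z y := fun h => by simp [soloCount, ho, h] at hy1
    have : I.filter (fun y => SoloIn E S z y) = ∅ :=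
      filter_eq_empty_iff.2 fun w hw h => hi (huniq w hw (Or.inr h) ▸ h)
    rw [this, card_empty]
    omega
  · have : I.filter (fun y => SoloOut E S z y) = ∅ :=
      filter_eq_empty_iff.2 fun w hw h => ho (huniq w hw (Or.inl h) ▸ h)
    rw [this, card_empty]
    omega

/-- The solo count of `y` towards a set to which it cannot be added compensates for a small
degree. -/
lemma four_le_sum_soloCount_add_deg (hy : ¬ E y y) (hS : Acyc E S)
    (hn : ¬ Acyc E (insert y S)) : 4 ≤ ∑ z ∈ S, soloCount E S z y + deg E y S := by
  obtain ⟨a, ha, ha'⟩ := exists_relOut hy hS hn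
  obtain ⟨b, hb, hb'⟩ := exists_relIn hy hS hn
  have h1 := two_le_sum_of_exists (R := fun z => E y z) ⟨a, ha, ha'.1⟩
  have h2 := two_le_sum_of_exists (R := fun z => E z y) ⟨b, hb, hb'.1⟩
  have h3 : ∑ z ∈ S, soloCount E S z y + deg E y S =
      ∑ z ∈ S, ((if E y z then 1 else 0) +
        (if E y z ∧ ∀ w ∈ S, E y w → w = z then 1 else 0)) +
      ∑ z ∈ S, ((if E z y then 1 else 0) +
        (if E z y ∧ ∀ w ∈ S, E w y → w = z then 1 else 0)) := by
    rw [deg, ← sum_add_distrib, ← sum_add_distrib]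
    refine sum_congr rfl fun z _ => ?_
    unfold soloCount mult SoloOut SoloIn
    split_ifs <;> rfl
  omega

/-- The total solo weight of a vertex `y` of `I`. The degree bound gives all but one unit of the
asserted amount. The last unit comes from an edge of `I` at `y`, or else from parity: the relevant
degree of `y` is then even, and if the solo count of `y` is odd then some solo direction of `y`
is counted twice. -/
lemma le_sum_soloWeight {T : Finset ι} {K : ι → Finset V} {q : ℕ} (hE : ∀ v, ¬ E v v)
    (hK : ∀ W ∈ T, Acyc E (K W)) (hn : ∀ W ∈ T, ¬ Acyc E (insert y (K W))) (hIB : I ⊆ B)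
    (hdeg : ∑ W ∈ T, deg E y (K W) + deg E y B + 1 ≤ 2 * q + 2 * #T) :
    2 * #T + 2 + relDeg E I y (B \ I) ≤
      ∑ W ∈ T, ∑ z ∈ K W, soloWeight E (K W) I z y + 2 * q := by
  have h1 : 4 * #T ≤ ∑ W ∈ T, ∑ z ∈ K W, soloCount E (K W) z y + ∑ W ∈ T, deg E y (K W) := by
    rw [← sum_add_distrib, mul_comm, ← smul_eq_mul, ← sum_const]
    exact sum_le_sum fun W hW => four_le_sum_soloCount_add_deg (hE y) (hK W hW) (hn W hW)
  have h2 : deg E y B = deg E y I + deg E y (B \ I) := by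
    rw [← deg_union disjoint_sdiff, union_sdiff_of_subset hIB]
  have h3 : relDeg E I y (B \ I) ≤ deg E y (B \ I) := relDeg_le_deg
  have h4 : ∑ W ∈ T, ∑ z ∈ K W, soloWeight E (K W) I z y =
      ∑ W ∈ T, ∑ z ∈ K W, soloCount E (K W) z y +
      ∑ W ∈ T, ∑ z ∈ K W, (if soloCount E (K W) z y = 1 ∧ deg E y I = 0 then 1 else 0) := by
    simp only [soloWeight, sum_add_distrib]
  by_cases h0 : deg E y I = 0
  swap
  · omega
  obtain ⟨m, hm⟩ := even_relDeg (T := B \ I) h0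
  rcases Nat.even_or_odd (∑ W ∈ T, ∑ z ∈ K W, soloCount E (K W) z y) with ⟨n, h5⟩ | h5
  · omega
  · have h6 : ∃ W ∈ T, ∃ z ∈ K W, soloCount E (K W) z y = 1 := by
      by_contra! hcon
      refine Nat.not_even_iff_odd.2 h5 ?_
      refine Finset.even_sum _ fun W hW => Finset.even_sum _ fun z hz => ?_
      have := hcon W hW z hz
      unfold soloCount at this ⊢
      split_ifs at this ⊢ <;> simp_all
    obtain ⟨W, hW, z, hz, hWz⟩ := h6
    have h7 : 1 ≤ ∑ W ∈ T, ∑ z ∈ K W,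
        (if soloCount E (K W) z y = 1 ∧ deg E y I = 0 then 1 else 0) := by
      refine le_trans ?_ (single_le_sum (fun _ _ => Nat.zero_le _) hW)
      refine le_trans ?_ (single_le_sum (fun _ _ => Nat.zero_le _) hz)
      simp [hWz, h0]
    omega

/-- There are two vertices of `B` that can together replace a vertex `z` of a class of `T`, the
first of them having `z` as its only in- or out-neighbor in that class. Otherwise the total solo
weight between a maximal acyclic set `I` and the classes would be too small. -/
lemma exists_replacing_pair {T : Finset ι} {K : ι → Finset V} {q s : ℕ} (hE : ∀ v, ¬ E v v)
    (hK : ∀ W ∈ T, Acyc E (K W)) (hs : ∀ W ∈ T, #(K W) = s)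
    (hn : ∀ y ∈ B, ∀ W ∈ T, ¬ Acyc E (insert y (K W)))
    (hdeg : ∀ y ∈ B, ∑ W ∈ T, deg E y (K W) + deg E y B + 1 ≤ 2 * q + 2 * #T)
    (hB : q * s + 1 ≤ #B) (hqT : q ≤ #T) (hIB : I ⊆ B) (hI : Acyc E I) (hsI : s ≤ #I)
    (hmax : ∀ v ∈ B \ I, ¬ Acyc E (insert v I)) :
    ∃ W ∈ T, ∃ z ∈ K W, ∃ x ∈ B, ∃ y ∈ B, x ≠ y ∧
      (SoloOut E (K W) z x ∨ SoloIn E (K W) z x) ∧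
      Acyc E (insert x (insert y ((K W).erase z))) := by
  by_contra! hcon
  have h1 : ∑ y ∈ I, ∑ W ∈ T, ∑ z ∈ K W, soloWeight E (K W) I z y ≤ #T * (s * 2) := by
    rw [sum_comm, ← smul_eq_mul, ← sum_const]
    refine sum_le_sum fun W hW => ?_
    rw [sum_comm, ← hs W hW, ← smul_eq_mul, ← sum_const]
    exact sum_le_sum fun z hz => sum_soloWeight_le_two hE (hK W hW) hI
      fun x hx y hy hxy => hcon W hW z hz x (hIB hx) y (hIB hy) hxy
  have h2 : ∑ y ∈ I, (2 * #T + 2 + relDeg E I y (B \ I)) ≤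
      ∑ y ∈ I, (∑ W ∈ T, ∑ z ∈ K W, soloWeight E (K W) I z y + 2 * q) :=
    sum_le_sum fun y hy => le_sum_soloWeight hE hK (hn y (hIB hy)) hIB (hdeg y (hIB hy))
  have h3 := two_mul_card_le_sum_relDeg hE hI hmax
  have h4 := card_sdiff_add_card_eq_card hIB
  simp only [sum_add_distrib, sum_const, smul_eq_mul] at h2 h1
  obtain ⟨e, he⟩ := Nat.exists_eq_add_of_le hqT
  rw [he] at h1 h2
  have h5 : e * s ≤ e * #I := Nat.mul_le_mul_left e hsI
  nlinarith

end

/-! ### Nearly equitable colorings -/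

section

variable {E : V → V → Prop} {X : Finset V} {C A : Finset ι} {s : ℕ} {f : V → ι} {p P W : ι}
  {v x y z : V}

/-- The subdigraph induced by `X` has a coloring with color set `C` all of whose classes are
acyclic and have exactly `s` vertices. -/
def HasEquitable (E : V → V → Prop) (X : Finset V) (C : Finset ι) (s : ℕ) : Prop :=
  ∃ f : V → ι, (∀ x ∈ X, f x ∈ C) ∧ ∀ c ∈ C, Acyc E (cls X f c) ∧ #(cls X f c) = s

/-- An acyclic coloring of `X` with color set `C` whose classes have `s` vertices, except that the
class of `p` has `s - 1` and the class of `P` has `s + 1` vertices. -/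
structure NearlyEquitable (E : V → V → Prop) (X : Finset V) (C : Finset ι) (s : ℕ) (f : V → ι)
    (p P : ι) : Prop where
  mem : ∀ x ∈ X, f x ∈ C
  acyc : ∀ c, Acyc E (cls X f c)
  small_mem : p ∈ C
  large_mem : P ∈ C
  ne : p ≠ P
  card : ∀ c ∈ C, #(cls X f c) + (if c = p then 1 else 0) = s + (if c = P then 1 else 0)

lemma deg_filter_mem (v : V) (X : Finset V) (f : V → ι) (A : Finset ι) :
    deg E v (X.filter (f · ∈ A)) = ∑ c ∈ A, deg E v (cls X f c) := by
  unfold deg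
  rw [← sum_fiberwise_of_maps_to (t := A) (g := f) (fun x hx => (mem_filter.1 hx).2)]
  refine sum_congr rfl fun c hc => sum_congr ?_ fun _ _ => rfl
  ext x
  simp only [mem_filter, mem_cls]
  constructor
  · rintro ⟨⟨h1, _⟩, h3⟩; exact ⟨h1, h3⟩
  · rintro ⟨h1, rfl⟩; exact ⟨⟨h1, hc⟩, rfl⟩

lemma exists_deg_cls_le_one {Y : Finset V} {D : Finset ι} (hf : ∀ x ∈ Y, f x ∈ D)
    (hd : deg E v Y + 1 ≤ 2 * #D) : ∃ b ∈ D, deg E v (cls Y f b) ≤ 1 := by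
  by_contra! hcon
  have h1 : #D * 2 ≤ ∑ c ∈ D, deg E v (cls Y f c) := by
    rw [← smul_eq_mul, ← sum_const]
    exact sum_le_sum fun c hc => hcon c hc
  rw [← deg_filter_mem, filter_true_of_mem hf] at h1
  omega

/-- The vertices of `X` whose color is not in `A`. -/
def outside (X : Finset V) (f : V → ι) (A : Finset ι) : Finset V := X.filter (f · ∉ A)

lemma mem_outside : x ∈ outside X f A ↔ x ∈ X ∧ f x ∉ A := mem_filter

/-- A vertex that cannot be added to the classes of `D` has at least two edges to each of
them. -/
lemma two_mul_card_add_deg_le (hE : ∀ v, ¬ E v v) (hac : ∀ c, Acyc E (cls X f c))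
    {D : Finset ι} (hDA : D ⊆ A) (hn : ∀ c ∈ D, ¬ Acyc E (insert v (cls X f c))) :
    2 * #D + ∑ c ∈ A \ D, deg E v (cls X f c) + deg E v (outside X f A) ≤ deg E v X := by
  have h1 : deg E v X = ∑ c ∈ A, deg E v (cls X f c) + deg E v (outside X f A) := by
    rw [← deg_filter_mem]
    exact (sum_filter_add_sum_filter_not X (f · ∈ A) _).symm
  have h2 := sum_sdiff (f := fun c => deg E v (cls X f c)) hDA
  have h3 : #D * 2 ≤ ∑ c ∈ D, deg E v (cls X f c) := by
    rw [← smul_eq_mul, ← sum_const]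
    exact sum_le_sum fun c hc => two_le_deg (hE v) (hac c) (hn c hc)
  omega

lemma NearlyEquitable.card_outside (h : NearlyEquitable E X C s f p P) (hp : p ∈ A)
    (hP : P ∉ A) : #(outside X f A) = #(C \ A) * s + 1 := by
  rw [card_eq_sum_card_fiberwise (f := f) (t := C \ A)]
  swap
  · intro x hx
    have hx := mem_outside.1 hx
    exact mem_coe.2 (mem_sdiff.2 ⟨h.mem x hx.1, hx.2⟩)
  have : ∀ c ∈ C \ A, #((outside X f A).filter (f · = c)) = s + (if c = P then 1 else 0) := by
    intro c hc
    rw [mem_sdiff] at hc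
    have h1 := h.card c hc.1
    have hcp : c ≠ p := fun h => hc.2 (h ▸ hp)
    rw [if_neg hcp, add_zero] at h1
    rw [← h1]
    congr 1
    ext x
    simp only [mem_filter, mem_outside, mem_cls]
    constructor
    · rintro ⟨⟨h1, _⟩, h3⟩; exact ⟨h1, h3⟩
    · rintro ⟨h2, rfl⟩; exact ⟨⟨h2, hc.2⟩, rfl⟩
  rw [sum_congr rfl this, sum_add_distrib, sum_const, smul_eq_mul, sum_ite_eq',
    if_pos (mem_sdiff.2 ⟨h.large_mem, hP⟩)]

lemma NearlyEquitable.hasEquitable_of_reach (h : NearlyEquitable E X C s f p P) (hAC : A ⊆ C)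
    (hP : Reach (Move E X f) A P p) : HasEquitable E X C s := by
  obtain ⟨g, hg1, hg2, hg3, -, hg5⟩ := exists_shift A P hP h.acyc
  refine ⟨g, fun x hx => ?_, fun c hc => ⟨hg3 c, ?_⟩⟩
  · by_cases hxA : f x ∈ A
    · exact hAC (hg2 x hxA)
    · rw [hg1 x hxA]; exact h.mem x hx
  · have h1 := hg5 c
    have h2 := h.card c hc
    omega

/-- If a vertex `z` of a class `W` can be moved to another class `X₀` that reaches `p` without
using `W`, and `y` can take the place of `z`, then the classes of `A` together with `y` become
equitable, and an equitable coloring of the remaining vertices completes the coloring. -/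
lemma NearlyEquitable.hasEquitable_of_move (h : NearlyEquitable E X C s f p P) (hAC : A ⊆ C)
    (hP : P ∉ A) (hW : W ∈ A) (hWp : W ≠ p) {X₀ : ι} (hX₀ : X₀ ∈ A)
    (hX₀W : X₀ ≠ W) (hr : Reach (Move E X f) (A.erase W) X₀ p) (hz : z ∈ cls X f W)
    (hzX₀ : Acyc E (insert z (cls X f X₀))) (hy : y ∈ outside X f A)
    (hyW : Acyc E (insert y ((cls X f W).erase z)))
    (hB : HasEquitable E ((outside X f A).erase y) (C \ A) s) : HasEquitable E X C s := by
  obtain ⟨g, hgC, hg⟩ := hB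
  obtain ⟨f₁, hf1, hf2, hf3, hf4, hf5⟩ := exists_shift _ X₀ hr h.acyc
  obtain ⟨hzX, hzW⟩ := mem_cls.1 hz
  obtain ⟨hyX, hyA⟩ := mem_outside.1 hy
  have hzy : z ≠ y := by rintro rfl; exact hyA (hzW ▸ hW)
  have hf1W : ∀ x, f₁ x = W ↔ f x = W := by
    intro x
    by_cases hx : f x ∈ A.erase W
    · simp [(mem_erase.1 (hf2 x hx)).1, (mem_erase.1 hx).1]
    · rw [hf1 x hx]
  have hf1A : ∀ x, f₁ x ∈ A ↔ f x ∈ A := by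
    intro x
    by_cases hx : f x ∈ A.erase W
    · simp [mem_of_mem_erase (hf2 x hx), mem_of_mem_erase hx]
    · rw [hf1 x hx]
  let F : V → ι := fun x =>
    if x = z then X₀ else if x = y then W else if f x ∈ A then f₁ x else g x
  have hFz : F z = X₀ := if_pos rfl
  have hFy : F y = W := by simp [F, hzy.symm]
  have hFA : ∀ x, x ≠ z → x ≠ y → f x ∈ A → F x = f₁ x := by
    intro x h1 h2 h3; simp [F, h1, h2, h3]
  have hFB : ∀ x, x ≠ z → x ≠ y → f x ∉ A → F x = g x := by
    intro x h1 h2 h3; simp [F, h1, h2, h3]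
  have hgx : ∀ x ∈ X, x ≠ y → f x ∉ A → g x ∈ C \ A := fun x hx hxy hxA =>
    hgC x (mem_erase.2 ⟨hxy, mem_outside.2 ⟨hx, hxA⟩⟩)
  have hclsB : ∀ c ∈ C \ A, cls X F c = cls ((outside X f A).erase y) g c := by
    intro c hc
    have hcA := (mem_sdiff.1 hc).2
    ext x
    simp only [mem_cls, mem_erase, mem_outside]
    by_cases hxz : x = z
    · subst hxz
      have h1 : X₀ ≠ c := fun h => hcA (h ▸ hX₀)
      simp [hFz, h1, hzW, hW]
    by_cases hxy : x = y
    · subst hxy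
      have h1 : W ≠ c := fun h => hcA (h ▸ hW)
      simp [hFy, h1]
    by_cases hxA : f x ∈ A
    · have h1 : f₁ x ≠ c := fun h => hcA (h ▸ (hf1A x).2 hxA)
      simp [hFA x hxz hxy hxA, h1, hxA]
    · simp [hFB x hxz hxy hxA, hxA, hxy]
  have hclsW : cls X F W = insert y ((cls X f W).erase z) := by
    ext x
    simp only [mem_cls, mem_erase, mem_insert]
    by_cases hxz : x = z
    · subst hxz
      simp [hFz, hX₀W, hzy]
    by_cases hxy : x = y
    · subst hxy
      simp [hFy, hyX]
    by_cases hxA : f x ∈ A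
    · simp [hFA x hxz hxy hxA, hf1W, hxz, hxy]
    · have h1 : f x ≠ W := fun h => hxA (h ▸ hW)
      have h2 : x ∈ X → g x ≠ W := fun hx h =>
        (mem_sdiff.1 (hgx x hx hxy hxA)).2 (h ▸ hW)
      simp only [hFB x hxz hxy hxA, hxy, h1]
      tauto
  have hclsX₀ : cls X F X₀ = insert z (cls X f₁ X₀) := by
    ext x
    simp only [mem_cls, mem_insert]
    by_cases hxz : x = z
    · subst hxz
      simp [hFz, hzX]
    by_cases hxy : x = y
    · subst hxy
      have h1 : f₁ x ≠ X₀ := fun h => hyA ((hf1A x).1 (h ▸ hX₀))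
      simp [hFy, hX₀W.symm, hxz, h1]
    by_cases hxA : f x ∈ A
    · simp [hFA x hxz hxy hxA, hxz]
    · have h1 : f₁ x ≠ X₀ := fun h => hxA ((hf1A x).1 (h ▸ hX₀))
      have h2 : x ∈ X → g x ≠ X₀ := fun hx h =>
        (mem_sdiff.1 (hgx x hx hxy hxA)).2 (h ▸ hX₀)
      simp only [hFB x hxz hxy hxA, hxz, h1]
      tauto
  have hclsA : ∀ c ∈ A, c ≠ W → c ≠ X₀ → cls X F c = cls X f₁ c := by
    intro c hc hcW hcX₀
    ext x
    simp only [mem_cls]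
    by_cases hxz : x = z
    · subst hxz
      have h1 : f₁ x = W := (hf1W x).2 hzW
      simp [hFz, h1, hcW.symm, hcX₀.symm]
    by_cases hxy : x = y
    · subst hxy
      have h1 : f₁ x ≠ c := fun h => hyA ((hf1A x).1 (h ▸ hc))
      simp [hFy, hcW.symm, h1]
    by_cases hxA : f x ∈ A
    · simp [hFA x hxz hxy hxA]
    · have h1 : f₁ x ≠ c := fun h => hxA ((hf1A x).1 (h ▸ hc))
      have h2 : x ∈ X → g x ≠ c := fun hx h =>
        (mem_sdiff.1 (hgx x hx hxy hxA)).2 (h ▸ hc)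
      simp only [hFB x hxz hxy hxA, h1]
      tauto
  have hcard : ∀ c ∈ A, #(cls X f₁ c) + (if c = X₀ then 1 else 0) = s := by
    intro c hc
    have h1 := h.card c (hAC hc)
    have hcP : c ≠ P := fun h => hP (h ▸ hc)
    rw [if_neg hcP] at h1
    rw [hf5 c, h1, add_zero]
  refine ⟨F, fun x hx => ?_, fun c hc => ?_⟩
  · by_cases hxz : x = z
    · rw [hxz, hFz]; exact hAC hX₀
    by_cases hxy : x = y
    · rw [hxy, hFy]; exact hAC hW
    by_cases hxA : f x ∈ A
    · rw [hFA x hxz hxy hxA]; exact hAC ((hf1A x).2 hxA)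
    · rw [hFB x hxz hxy hxA]; exact (mem_sdiff.1 (hgx x hx hxy hxA)).1
  by_cases hcA : c ∈ A
  swap
  · have hc' := mem_sdiff.2 ⟨hc, hcA⟩
    rw [hclsB c hc']
    exact hg c hc'
  by_cases hcW : c = W
  · subst hcW
    rw [hclsW]
    refine ⟨hyW, ?_⟩
    have h1 := h.card c (hAC hcA)
    have hcP : c ≠ P := fun h => hP (h ▸ hcA)
    rw [if_neg hcP, if_neg hWp] at h1
    have hyn : y ∉ (cls X f c).erase z := fun h =>
      hyA ((mem_cls.1 (mem_of_mem_erase h)).2 ▸ hcA)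
    have := card_pos.2 ⟨z, hz⟩
    rw [card_insert_of_notMem hyn, card_erase_of_mem hz]
    omega
  by_cases hcX₀ : c = X₀
  · subst hcX₀
    rw [hclsX₀]
    refine ⟨hzX₀.mono (insert_subset_insert _ hf4), ?_⟩
    have hzn : z ∉ cls X f₁ c := fun h =>
      hX₀W ((mem_cls.1 h).2.symm.trans ((hf1W z).2 hzW))
    have h1 := hcard c hcA
    rw [card_insert_of_notMem hzn]
    simpa using h1
  · rw [hclsA c hcA hcW hcX₀]
    have h1 := hcard c hcA
    rw [if_neg hcX₀] at h1
    exact ⟨hf3 c, h1⟩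

/-- If `x` and `y` can together replace a vertex `z` of a class `W`, then `x` is moved to `W` and
`z` to some class outside `A`, after recoloring there. The classes of `A` still reach `p`, and now
so does the class of `y`. -/
lemma NearlyEquitable.exists_nearlyEquitable_insert (h : NearlyEquitable E X C s f p P)
    (hE : ∀ v, ¬ E v v) (hAC : A ⊆ C) (hp : p ∈ A) (hP : P ∉ A) (hW : W ∈ A) (hWp : W ≠ p)
    (hA : ∀ c ∈ A, c ≠ W → Reach (Move E X f) (A.erase W) c p)
    (hrW : Reach (Move E X f) A W p) (hz : z ∈ cls X f W)
    (hzn : ∀ c ∈ A, c ≠ W → ¬ Acyc E (insert z (cls X f c)))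
    (hx : x ∈ outside X f A) (hy : y ∈ outside X f A) (hxy : x ≠ y)
    (hxyW : Acyc E (insert x (insert y ((cls X f W).erase z))))
    (hB : HasEquitable E ((outside X f A).erase x) (C \ A) s)
    (hzB : deg E z ((outside X f A).erase x) + 1 ≤ 2 * #(C \ A)) :
    ∃ (F : V → ι) (b e : ι), NearlyEquitable E X C s F p b ∧ e ∈ C ∧ e ∉ A ∧
      ∀ c ∈ insert e A, Reach (Move E X F) (insert e A) c p := by
  obtain ⟨g, hgC, hg⟩ := hB
  obtain ⟨b, hb, hbz⟩ := exists_deg_cls_le_one hgC hzB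
  obtain ⟨hbC, hbA⟩ := mem_sdiff.1 hb
  obtain ⟨hzX, hzW⟩ := mem_cls.1 hz
  obtain ⟨hxX, hxA⟩ := mem_outside.1 hx
  obtain ⟨hyX, hyA⟩ := mem_outside.1 hy
  have hzx : z ≠ x := by rintro rfl; exact hxA (hzW ▸ hW)
  have hzy : z ≠ y := by rintro rfl; exact hyA (hzW ▸ hW)
  let F : V → ι := fun v =>
    if v = z then b else if v = x then W else if f v ∈ A then f v else g v
  have hFz : F z = b := if_pos rfl
  have hFx : F x = W := by simp [F, hzx.symm]
  have hFA : ∀ v, v ≠ z → v ≠ x → f v ∈ A → F v = f v := by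
    intro v h1 h2 h3; simp [F, h1, h2, h3]
  have hFB : ∀ v, v ≠ z → v ≠ x → f v ∉ A → F v = g v := by
    intro v h1 h2 h3; simp [F, h1, h2, h3]
  have hgv : ∀ v ∈ X, v ≠ x → f v ∉ A → g v ∈ C \ A := fun v hv hvx hvA =>
    hgC v (mem_erase.2 ⟨hvx, mem_outside.2 ⟨hv, hvA⟩⟩)
  have hclsB : ∀ c, c ∉ A → c ≠ b → cls X F c = cls ((outside X f A).erase x) g c := by
    intro c hcA hcb
    ext v
    simp only [mem_cls, mem_erase, mem_outside]
    by_cases hvz : v = z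
    · subst hvz
      simp [hFz, hcb.symm, hzW, hW]
    by_cases hvx : v = x
    · subst hvx
      have h1 : W ≠ c := fun h => hcA (h ▸ hW)
      simp [hFx, h1]
    by_cases hvA : f v ∈ A
    · have h1 : f v ≠ c := fun h => hcA (h ▸ hvA)
      simp [hFA v hvz hvx hvA, h1, hvA]
    · simp [hFB v hvz hvx hvA, hvA, hvx]
  have hclsb : cls X F b = insert z (cls ((outside X f A).erase x) g b) := by
    ext v
    simp only [mem_cls, mem_insert, mem_erase, mem_outside]
    by_cases hvz : v = z
    · subst hvz
      simp [hFz, hzX]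
    by_cases hvx : v = x
    · subst hvx
      have h1 : W ≠ b := fun h => hbA (h ▸ hW)
      simp [hFx, h1, hvz]
    by_cases hvA : f v ∈ A
    · have h1 : f v ≠ b := fun h => hbA (h ▸ hvA)
      simp [hFA v hvz hvx hvA, h1, hvA, hvz]
    · simp [hFB v hvz hvx hvA, hvA, hvx, hvz]
  have hclsW : cls X F W = insert x ((cls X f W).erase z) := by
    ext v
    simp only [mem_cls, mem_erase, mem_insert]
    by_cases hvz : v = z
    · subst hvz
      have h1 : b ≠ W := fun h => hbA (h ▸ hW)
      simp [hFz, h1, hzx]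
    by_cases hvx : v = x
    · subst hvx
      simp [hFx, hxX]
    by_cases hvA : f v ∈ A
    · simp [hFA v hvz hvx hvA, hvz, hvx]
    · have h1 : f v ≠ W := fun h => hvA (h ▸ hW)
      have h2 : v ∈ X → g v ≠ W := fun hv h =>
        (mem_sdiff.1 (hgv v hv hvx hvA)).2 (h ▸ hW)
      simp only [hFB v hvz hvx hvA, hvx, h1]
      tauto
  have hclsA : ∀ c ∈ A, c ≠ W → cls X F c = cls X f c := by
    intro c hc hcW
    ext v
    simp only [mem_cls]
    by_cases hvz : v = z
    · subst hvz
      have h1 : b ≠ c := fun h => hbA (h ▸ hc)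
      simp [hFz, hzW, h1, hcW.symm]
    by_cases hvx : v = x
    · subst hvx
      have h1 : f v ≠ c := fun h => hxA (h ▸ hc)
      simp [hFx, hcW.symm, h1]
    by_cases hvA : f v ∈ A
    · simp [hFA v hvz hvx hvA]
    · have h1 : f v ≠ c := fun h => hvA (h ▸ hc)
      have h2 : v ∈ X → g v ≠ c := fun hv h =>
        (mem_sdiff.1 (hgv v hv hvx hvA)).2 (h ▸ hc)
      simp only [hFB v hvz hvx hvA, h1]
      tauto
  have hpb : p ≠ b := fun h => hbA (h ▸ hp)
  have hmemC : ∀ v ∈ X, F v ∈ C := by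
    intro v hv
    by_cases hvz : v = z
    · rw [hvz, hFz]; exact hbC
    by_cases hvx : v = x
    · rw [hvx, hFx]; exact hAC hW
    by_cases hvA : f v ∈ A
    · rw [hFA v hvz hvx hvA]; exact hAC hvA
    · rw [hFB v hvz hvx hvA]; exact (mem_sdiff.1 (hgv v hv hvx hvA)).1
  have hprop : ∀ c ∈ C, Acyc E (cls X F c) ∧
      #(cls X F c) + (if c = p then 1 else 0) = s + (if c = b then 1 else 0) := by
    intro c hc
    by_cases hcA : c ∈ A
    · have h1 := h.card c hc
      have hcP : c ≠ P := fun h => hP (h ▸ hcA)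
      have hcb : c ≠ b := fun h => hbA (h ▸ hcA)
      rw [if_neg hcP] at h1
      by_cases hcW : c = W
      · subst hcW
        rw [hclsW]
        refine ⟨hxyW.mono (insert_subset_insert _ (subset_insert _ _)), ?_⟩
        rw [if_neg hWp] at h1
        have hxn : x ∉ (cls X f c).erase z := fun h =>
          hxA ((mem_cls.1 (mem_of_mem_erase h)).2 ▸ hcA)
        have := card_pos.2 ⟨z, hz⟩
        rw [card_insert_of_notMem hxn, card_erase_of_mem hz, if_neg hWp, if_neg hcb]
        omega
      · rw [hclsA c hcA hcW, if_neg hcb]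
        exact ⟨h.acyc c, h1⟩
    · have hcp : c ≠ p := fun h => hcA (h ▸ hp)
      have h1 := hg c (mem_sdiff.2 ⟨hc, hcA⟩)
      by_cases hcb : c = b
      · subst hcb
        rw [hclsb]
        have hzn' : z ∉ cls ((outside X f A).erase x) g c := fun h =>
          (mem_outside.1 (mem_of_mem_erase (mem_cls.1 h).1)).2 (hzW ▸ hW)
        refine ⟨acyc_insert_of_deg_le_one hE h1.1 hbz, ?_⟩
        rw [card_insert_of_notMem hzn', h1.2, if_neg hcp, if_pos rfl]
      · rw [hclsB c hcA hcb, if_neg hcp, if_neg hcb]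
        exact ⟨h1.1, by rw [h1.2]⟩
  have hyC := mem_sdiff.1 (hgv y hyX hxy.symm hyA)
  have hFy : F y = g y := hFB y hzy.symm hxy.symm hyA
  refine ⟨F, b, g y, ⟨hmemC, fun c => ?_, h.small_mem, hbC, hpb, fun c hc => (hprop c hc).2⟩,
    hyC.1, hyC.2, ?_⟩
  · by_cases hc : c ∈ C
    · exact (hprop c hc).1
    · have : cls X F c = ∅ := filter_eq_empty_iff.2 fun v hv hvc => hc (hvc ▸ hmemC v hv)
      rw [this]
      exact acyc_empty
  have hsub : A ⊆ insert (g y) A := subset_insert _ _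
  have hother : ∀ c ∈ A, c ≠ W → Reach (Move E X F) (insert (g y) A) c p := by
    intro c hc hcW
    refine (hA c hc hcW).mono_of_imp ?_
    rintro a ha d hd ⟨had, w, hw, hwd⟩
    obtain ⟨haW, ha⟩ := mem_erase.1 ha
    obtain ⟨hdW, hd⟩ := mem_erase.1 hd
    refine ⟨hsub ha, hsub hd, had, w, ?_, ?_⟩
    · rw [hclsA a ha haW]; exact hw
    · rw [hclsA d hd hdW]; exact hwd
  have hWr : Reach (Move E X F) (insert (g y) A) W p := by
    obtain ⟨-, d, hd, ⟨hWd, w, hw, hwd⟩, -⟩ := hrW.exit hWp.symm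
    obtain ⟨hdW, hd⟩ := mem_erase.1 hd
    refine (hother d hd hdW).head (hsub hW) (hsub hd) ⟨hWd, w, ?_, ?_⟩
    · rw [hclsW]
      refine mem_insert_of_mem (mem_erase.2 ⟨?_, hw⟩)
      rintro rfl
      exact hzn d hd hdW hwd
    · rw [hclsA d hd hdW]; exact hwd
  intro c hc
  rcases mem_insert.1 hc with rfl | hc
  · refine hWr.head (mem_insert_self _ _) (hsub hW) ⟨?_, y, mem_cls.2 ⟨hyX, hFy⟩, ?_⟩
    · intro h
      exact hyC.2 (h ▸ hW)
    · rw [hclsW, insert_comm]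
      exact hxyW
  · by_cases hcW : c = W
    · rw [hcW]; exact hWr
    · exact hother c hc hcW

end

/-! ### From nearly equitable to equitable colorings -/

section

variable {E : V → V → Prop} {X : Finset V} {C A : Finset ι} {s : ℕ} {f : V → ι} {p P W : ι}
  {v x y z : V}

/-- A nearly equitable coloring in which the set `A` of classes that reach `p` is closed and does
not contain the large class either yields an equitable coloring or can be replaced by one with a
larger `A`. -/
lemma NearlyEquitable.improve (h : NearlyEquitable E X C s f p P) (hE : ∀ v, ¬ E v v)
    (hdeg : ∀ v ∈ X, deg E v X + 1 ≤ 2 * #C)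
    (ih : ∀ Y ⊂ X, ∀ D ⊆ C, #Y = #D * s → (∀ v ∈ Y, deg E v Y + 1 ≤ 2 * #D) →
      HasEquitable E Y D s)
    (hAC : A ⊆ C) (hp : p ∈ A) (hP : P ∉ A) (hA : ∀ c ∈ A, Reach (Move E X f) A c p)
    (hclosed : ∀ c ∈ C, c ∉ A → ∀ d ∈ A, ¬ Move E X f c d) :
    HasEquitable E X C s ∨
      ∃ (F : V → ι) (b e : ι), NearlyEquitable E X C s F p b ∧ e ∈ C ∧ e ∉ A ∧
        ∀ c ∈ insert e A, Reach (Move E X F) (insert e A) c p := by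
  set B := outside X f A with hBdef
  set q := #(C \ A) with hq
  have hqA : q + #A = #C := card_sdiff_add_card_eq_card hAC
  have hBcard : #B = q * s + 1 := h.card_outside hp hP
  have hBX : B ⊆ X := filter_subset _ _
  have hnB : ∀ y ∈ B, ∀ c ∈ A, ¬ Acyc E (insert y (cls X f c)) := by
    intro y hy c hc hac
    obtain ⟨hyX, hyA⟩ := mem_outside.1 hy
    exact hclosed (f y) (h.mem y hyX) hyA c hc
      ⟨fun h => hyA (h ▸ hc), y, mem_cls.2 ⟨hyX, rfl⟩, hac⟩
  have hBdeg : ∀ y ∈ B, deg E y B + 1 ≤ 2 * q := by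
    intro y hy
    have h1 := two_mul_card_add_deg_le hE h.acyc Subset.rfl (hnB y hy)
    have h2 := hdeg y (hBX hy)
    rw [← hBdef] at h1
    omega
  have hBih : ∀ y ∈ B, HasEquitable E (B.erase y) (C \ A) s := by
    intro y hy
    refine ih _ ((erase_ssubset hy).trans_subset hBX) _ sdiff_subset ?_ fun v hv => ?_
    · rw [card_erase_of_mem hy, hBcard]; rfl
    · exact (Nat.add_le_add_right (deg_mono (erase_subset _ _)) 1).trans
        (hBdeg v (mem_of_mem_erase hv))
  have hclsX : ∀ {c v}, v ∈ cls X f c → v ∈ X := fun hv => (mem_cls.1 hv).1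
  -- If `p` were the only class of `A`, there would be too few relevant edges between it and `B`.
  have hA2 : 2 ≤ #A := by
    by_contra hA1
    have hA1 : A = {p} := by
      refine (eq_of_subset_of_card_le (singleton_subset_iff.2 hp) ?_).symm
      rw [card_singleton]; omega
    have h1 := two_mul_card_le_sum_relDeg hE (h.acyc p) (fun y hy => hnB y hy p hp)
    have h2 : ∑ z ∈ cls X f p, relDeg E (cls X f p) z B ≤ #(cls X f p) * (2 * q) := by
      rw [← smul_eq_mul, ← sum_const]
      refine sum_le_sum fun z hz => relDeg_le ?_
      have h3 := two_mul_card_add_deg_le (D := ∅) (A := A) (v := z) hE h.acyc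
        (empty_subset _) (by simp)
      have h4 := hdeg z (hclsX hz)
      have h5 : #A = 1 := by rw [hA1, card_singleton]
      rw [sdiff_empty] at h3
      conv at h3 => enter [1, 1, 2, 1]; rw [hA1]
      rw [sum_singleton, ← hBdef] at h3
      simp only [card_empty] at h3
      omega
    have h3 := h.card p h.small_mem
    rw [if_pos rfl, if_neg h.ne] at h3
    have h4 : #(cls X f p) * q ≤ s * q := Nat.mul_le_mul_right _ (by omega)
    rw [hBcard] at h1
    nlinarith
  obtain ⟨U, hU, T, hTU, ⟨W₀, hW₀⟩, hpT, hterm, hstep⟩ := exists_terminal hp hA hA2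
  have hTA : T ⊆ A := hTU.trans (erase_subset _ _)
  have hWp : ∀ {W}, W ∈ T → W ≠ p := by
    rintro W hW rfl
    exact hpT hW
  have hWcard : ∀ W ∈ T, #(cls X f W) = s := by
    intro W hW
    have h1 := h.card W (hAC (hTA hW))
    rw [if_neg (hWp hW), if_neg (ne_of_mem_of_not_mem (hTA hW) hP)] at h1
    exact h1
  by_cases hmove : ∃ W ∈ T, ∃ z ∈ cls X f W, ∃ y ∈ B,
      Acyc E (insert y ((cls X f W).erase z)) ∧
      ∃ d ∈ A, d ≠ W ∧ Acyc E (insert z (cls X f d))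
  · obtain ⟨W, hW, z, hz, y, hy, hyW, d, hd, hdW, hzd⟩ := hmove
    exact Or.inl (h.hasEquitable_of_move hAC hP (hTA hW) (hWp hW) hd hdW
      (hterm W hW d hd hdW) hz hzd hy hyW (hBih y hy))
  right
  push Not at hmove
  have hdegsolo : ∀ W ∈ T, ∀ z ∈ cls X f W, ∀ y ∈ B, Acyc E (insert y ((cls X f W).erase z)) →
      deg E z (cls X f W) + deg E z B ≤ 2 * q + 1 := by
    intro W hW z hz y hy hyW
    have h1 := two_mul_card_add_deg_le (D := A.erase W) (A := A) hE h.acyc (erase_subset _ _)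
      (fun c hc => hmove W hW z hz y hy hyW c (mem_of_mem_erase hc) (ne_of_mem_erase hc))
    rw [sdiff_erase_self (hTA hW), sum_singleton, card_erase_of_mem (hTA hW), ← hBdef] at h1
    have h2 := hdeg z (hclsX hz)
    omega
  have hqT : q < #T := by
    refine lt_of_replaceable_deg_le hE (h.acyc W₀) (by rw [hWcard W₀ hW₀, hBcard])
      (fun y hy => hnB y hy W₀ (hTA hW₀)) (fun z hz => ?_) (hdegsolo W₀ hW₀)
    have hUT : insert U T ⊆ A := insert_subset hU hTA
    have h1 := two_mul_card_add_deg_le (D := A \ insert U T) (A := A) (v := z) hE h.acyc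
      sdiff_subset (by
        intro c hc hac
        rw [mem_sdiff, mem_insert, not_or] at hc
        exact hstep W₀ hW₀ c hc.1 hc.2.1 hc.2.2
          ⟨fun h => hc.2.2 (h ▸ hW₀), z, hz, hac⟩)
    rw [Finset.sdiff_sdiff_eq_self hUT, ← hBdef] at h1
    have h2 := card_sdiff_add_card_eq_card hUT
    have h3 : #(insert U T) = #T + 1 :=
      card_insert_of_notMem fun h => (mem_erase.1 (hTU h)).1 rfl
    have h4 : deg E z (cls X f W₀) ≤ ∑ c ∈ insert U T, deg E z (cls X f c) :=
      single_le_sum (f := fun c => deg E z (cls X f c)) (fun _ _ => Nat.zero_le _)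
        (mem_insert_of_mem hW₀)
    have h5 := hdeg z (hclsX hz)
    omega
  obtain ⟨I, hI, hImax⟩ := exists_max_image (B.powerset.filter (Acyc E ·)) Finset.card
    ⟨∅, mem_filter.2 ⟨empty_mem_powerset _, acyc_empty⟩⟩
  rw [mem_filter, mem_powerset] at hI
  have hsI : s ≤ #I := by
    have h1 := h.card P h.large_mem
    rw [if_pos rfl, if_neg h.ne.symm] at h1
    have h2 := hImax (cls X f P) (mem_filter.2 ⟨mem_powerset.2 fun v hv =>
      mem_outside.2 ⟨hclsX hv, (mem_cls.1 hv).2 ▸ hP⟩, h.acyc P⟩)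
    omega
  have hmaxI : ∀ v ∈ B \ I, ¬ Acyc E (insert v I) := by
    intro v hv hac
    rw [mem_sdiff] at hv
    have h1 := hImax (insert v I)
      (mem_filter.2 ⟨mem_powerset.2 (insert_subset hv.1 hI.1), hac⟩)
    rw [card_insert_of_notMem hv.2] at h1
    omega
  have hdegB : ∀ y ∈ B, ∑ W ∈ T, deg E y (cls X f W) + deg E y B + 1 ≤ 2 * q + 2 * #T := by
    intro y hy
    have h1 := two_mul_card_add_deg_le (D := A \ T) (A := A) hE h.acyc sdiff_subset
      (fun c hc => hnB y hy c (mem_sdiff.1 hc).1)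
    rw [Finset.sdiff_sdiff_eq_self hTA, ← hBdef] at h1
    have h2 := card_sdiff_add_card_eq_card hTA
    have h3 := hdeg y (hBX hy)
    omega
  obtain ⟨W, hW, z, hz, x, hx, y, hy, hxy, hsolo, hxyW⟩ :=
    exists_replacing_pair hE (fun W _ => h.acyc W) hWcard
      (fun y hy W hW => hnB y hy W (hTA hW)) hdegB hBcard.ge hqT.le hI.1 hI.2 hsI hmaxI
  have hxW : Acyc E (insert x ((cls X f W).erase z)) :=
    hxyW.mono (insert_subset_insert _ (subset_insert _ _))
  refine h.exists_nearlyEquitable_insert hE hAC hp hP (hTA hW) (hWp hW) (hterm W hW)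
    (hA W (hTA hW)) hz (hmove W hW z hz x hx hxW) hx hy hxy hxyW (hBih x hx) ?_
  have h1 := hdegsolo W hW z hz x hx hxW
  have h2 : deg E z (B.erase x) + mult E z x = deg E z B := sum_erase_add _ _ hx
  -- If `z` is isolated in its class, then `x` and `z` are joined by a 2-cycle.
  have h3 : deg E z (cls X f W) + mult E z x ≥ 2 := by
    have hadj : 1 ≤ mult E z x := by
      rcases hsolo with h | h
      · rw [mult_comm]; exact one_le_mult h.1
      · exact one_le_mult h.1
    by_cases h0 : deg E z (cls X f W) = 0
    swap
    · omega
    have hnx := hnB x hx W (hTA hW)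
    have h4 : E x z ∧ E z x := by
      rcases hsolo with h' | h'
      · obtain ⟨w, hw, hw1, hw2⟩ := exists_relOut (hE x) (h.acyc W) hnx
        obtain rfl := h'.2 w hw hw1
        exact ⟨hw1, hw2.resolve_right (not_not.2 h0)⟩
      · obtain ⟨w, hw, hw1, hw2⟩ := exists_relIn (hE x) (h.acyc W) hnx
        obtain rfl := h'.2 w hw hw1
        exact ⟨hw2.resolve_right (not_not.2 h0), hw1⟩
    simp [mult, h4.1, h4.2]
  rw [← hBdef]
  omega

/-- Under the degree condition, a nearly equitable coloring can be made equitable, provided that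
proper subsets have equitable colorings. -/
lemma NearlyEquitable.hasEquitable (hE : ∀ v, ¬ E v v)
    (hdeg : ∀ v ∈ X, deg E v X + 1 ≤ 2 * #C)
    (ih : ∀ Y ⊂ X, ∀ D ⊆ C, #Y = #D * s → (∀ v ∈ Y, deg E v Y + 1 ≤ 2 * #D) →
      HasEquitable E Y D s) (n : ℕ) :
    ∀ (f : V → ι) (p P : ι) (A : Finset ι), NearlyEquitable E X C s f p P → A ⊆ C → p ∈ A →
      (∀ c ∈ A, Reach (Move E X f) A c p) → #C ≤ #A + n → HasEquitable E X C s := by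
  induction n with
  | zero =>
    intro f p P A h hAC _ hA hn
    have : A = C := eq_of_subset_of_card_le hAC hn
    exact h.hasEquitable_of_reach hAC (hA P (this ▸ h.large_mem))
  | succ n ihn =>
    intro f p P A h hAC hp hA hn
    by_cases hP : P ∈ A
    · exact h.hasEquitable_of_reach hAC (hA P hP)
    by_cases hclosed : ∀ c ∈ C, c ∉ A → ∀ d ∈ A, ¬ Move E X f c d
    · rcases h.improve hE hdeg ih hAC hp hP hA hclosed with h' | ⟨F, b, e, hF, heC, heA, he⟩
      · exact h'
      · refine ihn F p b (insert e A) hF (insert_subset heC hAC) (mem_insert_of_mem hp) he ?_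
        rw [card_insert_of_notMem heA]
        omega
    · push Not at hclosed
      obtain ⟨c, hc, hcA, d, hd, hcd⟩ := hclosed
      refine ihn f p P (insert c A) h (insert_subset hc hAC) (mem_insert_of_mem hp) ?_ ?_
      · intro a ha
        have hsub : A ⊆ insert c A := subset_insert _ _
        rcases mem_insert.1 ha with rfl | ha
        · exact ((hA d hd).mono hsub).head (mem_insert_self _ _) (hsub hd) hcd
        · exact (hA a ha).mono hsub
      · rw [card_insert_of_notMem hcA]
        omega

/-! ### Equitable colorings -/

/-- A set of `#C * s` vertices can be split into `#C` classes of size `s`. -/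
lemma exists_balanced [Nonempty ι] (C : Finset ι) (s : ℕ) : ∀ X : Finset V, #X = #C * s →
    ∃ f : V → ι, (∀ x ∈ X, f x ∈ C) ∧ ∀ c ∈ C, #(cls X f c) = s := by
  induction C using Finset.induction_on with
  | empty =>
    intro X hX
    obtain rfl : X = ∅ := by simpa using hX
    exact ⟨fun _ => Classical.arbitrary ι, by simp, by simp⟩
  | insert a C ha ih =>
    intro X hX
    rw [card_insert_of_notMem ha] at hX
    obtain ⟨Y, hYX, hY⟩ := exists_subset_card_eq (s := X) (n := s) (by rw [hX]; nlinarith)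
    obtain ⟨g, hg1, hg2⟩ := ih (X \ Y) (by
      have := card_sdiff_add_card_eq_card hYX
      rw [hX] at this
      nlinarith)
    refine ⟨fun x => if x ∈ Y then a else g x, fun x hx => ?_, fun c hc => ?_⟩
    · by_cases hxY : x ∈ Y
      · simp [hxY]
      · simpa [hxY] using Or.inr (hg1 x (mem_sdiff.2 ⟨hx, hxY⟩))
    · rcases mem_insert.1 hc with rfl | hcC
      · rw [← hY]
        congr 1
        ext x
        rw [mem_cls]
        by_cases hxY : x ∈ Y
        · simp [hxY, hYX hxY]
        · simp only [hxY, if_false, iff_false, not_and]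
          intro hx h
          exact ha (h ▸ hg1 x (mem_sdiff.2 ⟨hx, hxY⟩))
      · rw [← hg2 c hcC]
        congr 1
        ext x
        have hca : a ≠ c := fun h => ha (h ▸ hcC)
        by_cases hxY : x ∈ Y
        · simp [mem_cls, hxY, hca]
        · simp [mem_cls, hxY]

/-- **Equitable acyclic coloring**: if `X` has `#C * s` vertices, of total degree at most
`2 * #C - 1` each, then it has an acyclic coloring with classes of size `s`. The edges are
introduced vertex by vertex; recoloring the vertex whose edges were added last leaves the coloring
equitable or makes it nearly equitable. -/
theorem hasEquitable_of_deg_le [Nonempty ι] (s : ℕ) (X : Finset V) :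
    ∀ (E : V → V → Prop) (C : Finset ι), (∀ v, ¬ E v v) → #X = #C * s →
      (∀ v ∈ X, deg E v X + 1 ≤ 2 * #C) → HasEquitable E X C s := by
  induction X using Finset.strongInduction with
  | H X ih =>
  intro E C hE hX hdeg
  let R : Finset V → V → V → Prop := fun U x y => E x y ∧ x ∈ U ∧ y ∈ U
  have hRdeg : ∀ U, ∀ v ∈ X, deg (R U) v X + 1 ≤ 2 * #C := by
    intro U v hv
    refine le_trans (Nat.add_le_add_right (sum_le_sum fun y _ => ?_) 1) (hdeg v hv)
    unfold mult
    split_ifs <;> simp_all [R]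
  have hRirr : ∀ U v, ¬ R U v v := fun U v h => hE v h.1
  have key : ∀ U : Finset V, U ⊆ X → HasEquitable (R U) X C s := by
    intro U
    induction U using Finset.induction_on with
    | empty =>
      intro _
      obtain ⟨f, hf1, hf2⟩ := exists_balanced C s X hX
      exact ⟨f, hf1, fun c hc => ⟨⟨fun _ => 0, fun x _ y _ h => by simp [R] at h⟩, hf2 c hc⟩⟩
    | insert u U hu ihU =>
      intro hUX
      obtain ⟨huX, hUX⟩ := insert_subset_iff.1 hUX
      obtain ⟨f, hfC, hf⟩ := ihU hUX
      set E' := R (insert u U) with hE'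
      obtain ⟨b, hb, hbu⟩ := exists_deg_cls_le_one (E := E') hfC (hRdeg _ u huX)
      have hac : ∀ c ∈ C, Acyc E' ((cls X f c).erase u) := by
        intro c hc
        obtain ⟨r, hr⟩ := (hf c hc).1
        refine ⟨r, fun x hx y hy hxy => hr x (mem_of_mem_erase hx) y (mem_of_mem_erase hy)
          ⟨hxy.1, ?_, ?_⟩⟩
        · exact (mem_insert.1 hxy.2.1).resolve_left (ne_of_mem_erase hx)
        · exact (mem_insert.1 hxy.2.2).resolve_left (ne_of_mem_erase hy)
      have hacb : Acyc E' (insert u ((cls X f b).erase u)) :=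
        acyc_insert_of_deg_le_one (hRirr _) (hac b hb)
          ((deg_mono (erase_subset _ _)).trans hbu)
      by_cases hub : f u = b
      · refine ⟨f, hfC, fun c hc => ⟨?_, (hf c hc).2⟩⟩
        by_cases hcb : c = b
        · subst hcb
          rwa [insert_erase (mem_cls.2 ⟨huX, hub⟩)] at hacb
        · have : u ∉ cls X f c := fun h => hcb ((mem_cls.1 h).2.symm.trans hub)
          rw [← erase_eq_of_notMem this]
          exact hac c hc
      let F := Function.update f u b
      have hFb : cls X F b = insert u ((cls X f b).erase u) := by
        ext x
        by_cases hx : x = u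
        · subst hx; simp [F, mem_cls, huX]
        · simp [F, mem_cls, hx]
      have hFc : ∀ c, c ≠ b → cls X F c = (cls X f c).erase u := by
        intro c hc
        ext x
        by_cases hx : x = u
        · subst hx; simp [F, mem_cls, hc.symm]
        · simp [F, mem_cls, hx]
      have hFC : ∀ x ∈ X, F x ∈ C := by
        intro x hx
        by_cases hxu : x = u
        · subst hxu; simpa [F] using hb
        · simpa [F, hxu] using hfC x hx
      have hF : NearlyEquitable E' X C s F (f u) b := by
        refine ⟨hFC, fun c => ?_, hfC u huX, hb, hub, fun c hc => ?_⟩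
        · by_cases hc : c ∈ C
          · by_cases hcb : c = b
            · rw [hcb, hFb]; exact hacb
            · rw [hFc c hcb]; exact hac c hc
          · have : cls X F c = ∅ := filter_eq_empty_iff.2 fun v hv hvc => hc (hvc ▸ hFC v hv)
            rw [this]
            exact acyc_empty
        · have h1 := (hf c hc).2
          by_cases hcb : c = b
          · subst hcb
            have hun : u ∉ cls X f c := fun h => hub (mem_cls.1 h).2
            rw [hFb, erase_eq_of_notMem hun, card_insert_of_notMem hun, h1,
              if_neg (Ne.symm hub), if_pos rfl]
          · rw [hFc c hcb, if_neg hcb]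
            by_cases hcu : c = f u
            · have huc : u ∈ cls X f c := mem_cls.2 ⟨huX, hcu.symm⟩
              have := card_pos.2 ⟨u, huc⟩
              rw [card_erase_of_mem huc, if_pos hcu]
              omega
            · have huc : u ∉ cls X f c := fun h => hcu (mem_cls.1 h).2.symm
              rw [erase_eq_of_notMem huc, if_neg hcu, h1]
      refine NearlyEquitable.hasEquitable (hRirr _) (hRdeg _)
        (fun Y hY D _ hYD hd => ih Y hY E' D (hRirr _) hYD hd) #C F (f u) b {f u} hF
        (singleton_subset_iff.2 (hfC u huX)) (mem_singleton_self _) ?_ (by omega)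
      intro c hc
      rw [mem_singleton.1 hc]
      exact Reach.refl
  obtain ⟨f, hfC, hf⟩ := key X Subset.rfl
  refine ⟨f, hfC, fun c hc => ⟨?_, (hf c hc).2⟩⟩
  obtain ⟨r, hr⟩ := (hf c hc).1
  exact ⟨r, fun x hx y hy hxy => hr x hx y hy ⟨hxy, (mem_cls.1 hx).1, (mem_cls.1 hy).1⟩⟩

end

/-! ### Finite digraphs and graphs -/

/-- The digraph on `V ⊕ Fin m` that extends `G` by a disjoint complete digraph on `m` vertices. -/
def padded (G : Digraph V) (m : ℕ) : V ⊕ Fin m → V ⊕ Fin m → Prop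
  | Sum.inl x, Sum.inl y => G.Adj x y
  | Sum.inr i, Sum.inr j => i ≠ j
  | _, _ => False

lemma totalDegree_eq_deg [Fintype V] (G : Digraph V) (v : V) :
    G.totalDegree v = deg G.Adj v univ := by
  rw [deg_eq_card, Digraph.totalDegree, Digraph.inDegree, Digraph.outDegree,
    Set.ncard_eq_toFinset_card', Set.ncard_eq_toFinset_card', add_comm]
  congr 2 <;> ext <;> simp

/-- A set with an increasing rank function induces an acyclic subdigraph. -/
lemma isAcyclic_induce {G : Digraph V} {S : Set V} {r : V → ℤ}
    (hr : ∀ x ∈ S, ∀ y ∈ S, G.Adj x y → r x < r y) : (G.induce S).IsAcyclic := by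
  intro c hc
  obtain ⟨hne, -, hchain⟩ := hc
  have h1 : c.Chain fun a b : S => r a < r b :=
    hchain.imp fun a b hab => hr a a.2 b b.2 hab
  obtain ⟨a, ha⟩ : ∃ a, a ∈ c := by
    induction c using Cycle.induction_on with
    | nil => exact absurd rfl hne
    | cons a l _ => exact ⟨a, by simp⟩
  have : IsTrans S fun a b : S => r a < r b := ⟨fun _ _ _ h h' => lt_trans h h'⟩
  exact lt_irrefl _ (Cycle.chain_iff_pairwise.1 h1 a ha a ha)

/-- Adding a complete digraph on fewer than `k` vertices makes the number of vertices divisible by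
`k`. As every class contains at most one of the new vertices, removing them leaves an equitable
coloring. -/
lemma exists_equitable [Fintype V] {k : ℕ} (hk : 1 ≤ k) (G : Digraph V) (hG : G.IsSimple)
    (hd : G.maxTotalDegree ≤ 2 * k - 1) : ∃ f : V → Fin k,
      (∀ i, ∃ r : V → ℤ, ∀ x y, f x = i → f y = i → G.Adj x y → r x < r y) ∧
      IsEquitableColoring f := by
  have hne : Nonempty (Fin k) := ⟨⟨0, hk⟩⟩
  obtain ⟨s, m, hmk, hcard⟩ : ∃ s m, m < k ∧ Fintype.card V + m = k * s := by
    refine ⟨(Fintype.card V + (k - 1)) / k, k - 1 - (Fintype.card V + (k - 1)) % k, by omega, ?_⟩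
    have h1 := Nat.div_add_mod (Fintype.card V + (k - 1)) k
    have h2 := Nat.mod_lt (Fintype.card V + (k - 1)) hk
    omega
  have hirr : ∀ v, ¬ padded G m v v := by
    rintro (v | i)
    · exact hG v
    · simp [padded]
  have hdeg : ∀ v ∈ (univ : Finset (V ⊕ Fin m)),
      deg (padded G m) v univ + 1 ≤ 2 * #(univ : Finset (Fin k)) := by
    rw [card_univ, Fintype.card_fin]
    rintro (v | i) -
    · have h1 : deg (padded G m) (Sum.inl v) univ = deg G.Adj v univ := by
        have h0 : ∀ j : Fin m, mult (padded G m) (Sum.inl v) (Sum.inr j) = 0 := fun j =>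
          not_not.1 (mult_pos_iff.not.2 (by simp [padded]))
        simp only [deg, Fintype.sum_sum_type, h0, sum_const_zero, add_zero]
        rfl
      have h2 : G.totalDegree v ≤ G.maxTotalDegree := le_sup (f := G.totalDegree) (mem_univ v)
      rw [h1, ← totalDegree_eq_deg]
      omega
    · have h1 : deg (padded G m) (Sum.inr i) univ ≤ ∑ j : Fin m, if i = j then 0 else 2 := by
        have h0 : ∀ w : V, mult (padded G m) (Sum.inr i) (Sum.inl w) = 0 := fun w =>
          not_not.1 (mult_pos_iff.not.2 (by simp [padded]))
        simp only [deg, Fintype.sum_sum_type, h0, sum_const_zero, zero_add]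
        refine sum_le_sum fun j _ => ?_
        by_cases hij : i = j
        · subst hij
          rw [if_pos rfl, Nat.le_zero]
          exact not_not.1 (mult_pos_iff.not.2 (by simp [padded]))
        · rw [if_neg hij]
          unfold mult
          split_ifs <;> omega
      have h2 : (∑ j : Fin m, if i = j then 0 else 2) + 2 = 2 * m := by
        have : ∀ j : Fin m, (if i = j then 0 else 2) + (if i = j then 2 else 0) = 2 := by
          intro j; split_ifs <;> rfl
        have h3 := sum_congr (rfl : (univ : Finset (Fin m)) = univ) fun j _ => this j
        rw [sum_add_distrib, sum_ite_eq, if_pos (mem_univ i)] at h3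
        simpa [mul_comm] using h3
      omega
  obtain ⟨f, -, hf⟩ := hasEquitable_of_deg_le s univ (padded G m) (univ : Finset (Fin k)) hirr
    (by simpa using hcard) hdeg
  refine ⟨fun v => f (Sum.inl v), fun i => ?_, fun i j => ?_⟩
  · obtain ⟨r, hr⟩ := (hf i (mem_univ i)).1
    exact ⟨fun v => r (Sum.inl v), fun x y hx hy hxy =>
      hr (Sum.inl x) (mem_cls.2 ⟨mem_univ _, hx⟩) (Sum.inl y) (mem_cls.2 ⟨mem_univ _, hy⟩) hxy⟩
  · have hsize : ∀ i, (((fun v => f (Sum.inl v)) ⁻¹' {i} : Set V)).ncard ≤ s ∧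
        s ≤ (((fun v => f (Sum.inl v)) ⁻¹' {i} : Set V)).ncard + 1 := by
      intro i
      obtain ⟨hac, hcs⟩ := hf i (mem_univ i)
      have h1 : ((fun v => f (Sum.inl v)) ⁻¹' {i} : Set V).ncard =
          #(univ.filter fun v : V => f (Sum.inl v) = i) := by
        rw [Set.ncard_eq_toFinset_card']
        congr 1
        ext; simp
      have h2 : #(cls univ f i) = #(univ.filter fun v : V => f (Sum.inl v) = i) +
          #(univ.filter fun j : Fin m => f (Sum.inr j) = i) := by
        rw [cls, card_filter, card_filter, card_filter, Fintype.sum_sum_type]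
        congr!
      have h3 : #(univ.filter fun j : Fin m => f (Sum.inr j) = i) ≤ 1 := by
        refine card_le_one.2 fun a ha b hb => ?_
        by_contra hab
        rw [mem_filter] at ha hb
        exact hac.not_two_cycle (mem_cls.2 ⟨mem_univ _, ha.2⟩) (mem_cls.2 ⟨mem_univ _, hb.2⟩)
          (show padded G m (Sum.inr a) (Sum.inr b) from hab) (Ne.symm hab)
      omega
    have hi := hsize i
    have hj := hsize j
    omega

end

end EquitableAcyclic

theorem theorem8 {V : Type*} [Fintype V] (k : ℕ) (hk : 1 ≤ k) :
    (∀ G : Digraph V, G.IsSimple → G.maxTotalDegree ≤ 2 * k - 1 →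
      ∃ f : V → Fin k, G.IsEquitableAcyclicColoring f) ∧
    (∀ (G : SimpleGraph V) [DecidableRel G.Adj], G.maxDegree ≤ k - 1 →
      ∃ f : G.Coloring (Fin k), IsEquitableColoring f) := by
  refine ⟨fun G hG hd => ?_, fun G _ hd => ?_⟩
  · obtain ⟨f, hf, hfe⟩ := EquitableAcyclic.exists_equitable hk G hG hd
    refine ⟨f, fun i => ?_, hfe⟩
    obtain ⟨r, hr⟩ := hf i
    exact EquitableAcyclic.isAcyclic_induce fun x hx y hy => hr x y hx hy
  · -- An acyclic set of the symmetric digraph has no 2-cycle, so it is independent in `G`.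
    have hdeg : ∀ v, (Digraph.mk G.Adj).totalDegree v = 2 * G.degree v := by
      intro v
      have h1 : {w | G.Adj v w}.ncard = G.degree v := by
        rw [← G.card_neighborFinset_eq_degree, ← Set.ncard_coe_finset]
        congr 1
        ext; simp
      have h2 : {w | G.Adj w v}.ncard = G.degree v := by
        rw [← h1]
        simp only [G.adj_comm]
      simp only [Digraph.totalDegree, Digraph.inDegree, Digraph.outDegree]
      omega
    obtain ⟨f, hf, hfe⟩ := EquitableAcyclic.exists_equitable hk (Digraph.mk G.Adj)
      (fun v => G.loopless.irrefl v) (Finset.sup_le fun v _ => by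
        have := G.degree_le_maxDegree v
        rw [hdeg]
        omega)
    refine ⟨SimpleGraph.Coloring.mk f fun {v w} hvw hc => ?_, hfe⟩
    obtain ⟨r, hr⟩ := hf (f w)
    exact lt_asymm (hr v w hc rfl hvw) (hr w v rfl hc hvw.symm)
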